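/- A weight on an interval $I\subseteq\mathbb R$ (of positive length, possibly $I=\mathbb R$) is a locally integrable function $w$ on $I$ that is positive almost everywhere on $I$. Write $\langle f\rangle_J=\frac1{|J|}\int_J f\,dx$, and put $$[w]_{RH_1(I)}=\sup_{J\subseteq I}\Big\langle \frac{w}{\langle w\rangle_J}\log\frac{w}{\langle w\rangle_J}\Big\rangle_J,\qquad [w]_{RH_p(I)}=\sup_{J\subseteq I}\frac{\langle w^p\rangle_J^{1/p}}{\langle w\rangle_J}\quad(1<p<\infty),$$ the suprema being taken over all compact intervals $J\subseteq I$ of positive length (an average is $+\infty$ if the integral diverges). We say $w\in RH_p(I)$, $1\le p<\infty$, if $w$ is a weight on $I$ with $[w]_{RH_p(I)}<\infty$. **Theorem (sharp Gehring lemma, $n=1$, $p=1$).** For every $Q>0$ the equation $$\frac1t-\log\Big(\frac1t+1\Big)=Q$$ has a smallest positive solution $\varepsilon_-=\varepsilon_-(Q)$, and $\varepsilon_-=\frac1{\gamma_+-1}$, where $\gamma_+=\gamma_+(Q)>1$ is the larger root in $(0,\infty)$ of $\gamma-\log\gamma=Q+1$. Put $\varepsilon_-(0)=+\infty$. 1.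 Let $I\subseteq\mathbb R$ be an interval of positive length (for instance $I=\mathbb R$). If $w\in RH_1(I)$, then $w\in RH_{1+\varepsilon}(I)$ for all $0<\varepsilon<\varepsilon_-([w]_{RH_1(I)})$. 2. This is sharp on $\mathbb R$: for every $C>0$ there is a weight $w\in RH_1(\mathbb R)$ with $[w]_{RH_1(\mathbb R)}=C$ and $w\notin RH_{1+\varepsilon_-(C)}(\mathbb R)$. 3. It is sharp on the half-line, with a power weight: for every $C>0$, the weight $w(t)=t^{(1-\gamma_+)/\gamma_+}$ on $[0,\infty)$, with $\gamma_+=\gamma_+(C)$, satisfies $w\in RH_1([0,\infty))$, $[w]_{RH_1([0,\infty))}=C$ and $w\notin RH_{1+\varepsilon_-(C)}([0,\infty))$. -/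

import Mathlib

open MeasureTheory Set

noncomputable section

/-- A weight on the interval `I` (the real line is `I = univ`): a locally integrable function on
`I` that is positive almost everywhere on `I`. -/
structure IsWeightOn (I : Set ℝ) (w : ℝ → ℝ) : Prop where
  locallyIntegrableOn : LocallyIntegrableOn w I volume
  ae_pos : ∀ᵐ x ∂(volume.restrict I), 0 < w x

/-- The average of `f` over the bounded interval `[a, b]`. -/
def intervalMean (f : ℝ → ℝ) (a b : ℝ) : ℝ := ⨍ x in Icc a b, f x

/-- The function `(w / m) log (w / m)` where `m` is the average of `w` over `[a, b]`. -/
def entropyFun (w : ℝ → ℝ) (a b : ℝ) (x : ℝ) : ℝ :=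
  w x / intervalMean w a b * Real.log (w x / intervalMean w a b)

open Classical in
/-- The average over `[a, b]` of `(w / m) log (w / m)`, as an extended real. The integrand is
bounded below, so for a weight the average is `+∞` exactly when the integrand is not integrable. -/
def entropyMean (w : ℝ → ℝ) (a b : ℝ) : EReal :=
  if IntegrableOn (entropyFun w a b) (Icc a b) volume then
    ((intervalMean (entropyFun w a b) a b : ℝ) : EReal)
  else ⊤

/-- The `RH_1` constant of `w` on the interval `I`: the supremum of `entropyMean w a b` over all
bounded intervals `[a, b] ⊆ I` with `a < b`. -/
def RHOneConst (I : Set ℝ) (w : ℝ → ℝ) : EReal :=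
  ⨆ (a : ℝ) (b : ℝ) (_ : a < b) (_ : Icc a b ⊆ I), entropyMean w a b

/-- The class `RH_1` on the interval `I`. -/
def MemRHOne (I : Set ℝ) (w : ℝ → ℝ) : Prop := IsWeightOn I w ∧ RHOneConst I w < ⊤

/-- The `RH_p` constant of `w` on the interval `I`: the supremum of
`(average of w ^ p) ^ (1 / p) / (average of w)` over all bounded intervals `[a, b] ⊆ I`. -/
def RHConst (p : ℝ) (I : Set ℝ) (w : ℝ → ℝ) : ENNReal :=
  ⨆ (a : ℝ) (b : ℝ) (_ : a < b) (_ : Icc a b ⊆ I),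
    ((∫⁻ x in Icc a b, ENNReal.ofReal (w x ^ p)) / ENNReal.ofReal (b - a)) ^ (1 / p) /
      ENNReal.ofReal (intervalMean w a b)

/-- The class `RH_p` on the interval `I`, for `1 < p < ∞`. -/
def MemRH (p : ℝ) (I : Set ℝ) (w : ℝ → ℝ) : Prop := IsWeightOn I w ∧ RHConst p I w < ⊤

/-- `e` is the smallest positive solution `t` of `1 / t - log (1 / t + 1) = Q`. -/
def IsEpsMinus (Q e : ℝ) : Prop :=
  IsLeast {t : ℝ | 0 < t ∧ 1 / t - Real.log (1 / t + 1) = Q} e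

/-- `g` is the larger root of `g - log g = Q + 1` in `(0, ∞)`. -/
def IsGammaPlus (Q g : ℝ) : Prop :=
  IsGreatest {g : ℝ | 0 < g ∧ g - Real.log g = Q + 1} g

end

/-! Let g > 1 satisfy g - log g = Q + 1. On an interval of entropy at most Q, the averages of (w, w
log w) form a point between the curves x log x and x log x + Q x. The line through (β, β log β)
tangent to the upper curve touches it at x = gβ, and `tangentGap g β` is the height of w log w above
this line. Entropy at most Q therefore gives ∫ `tangentGap g β` ≤ 0 for β = mean / g, and conversely
this inequality for a single β > 0 forces entropy at most Q.

Self-improvement. Fix an interval of mean m and a level β ≥ m / g. A rising-sun decomposition at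
height gβ gives disjoint intervals of mean exactly gβ, outside which w ≤ gβ almost everywhere. Since
the gap is nonnegative for w ≤ β and nonpositive for β ≤ w ≤ gβ, the inequalities on these intervals
add up to ∫_{w > β} `tangentGap g β` ≤ 0 (`integral_posGap_nonpos`). Multiplying by β^(ε-1) and
integrating in β leaves a multiple of ∫ w^(1+ε), with coefficient 1/ε² - g/(ε(1+ε)), which is
positive exactly when ε < 1/(g-1). Truncating w at N keeps all terms finite
(`integral_min_rpow_le`), and N → ∞ gives `memRH_of_entropyMean_le`.

Sharpness. It is enough to find a weight with constant at most C that fails at the critical exponent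
r = g/(g-1): a smaller constant would put r inside the range of self-improvement
(`RHOneConst_eq_of_not_memRH`). On the half-line a power weight w has w^r = 1/t. On the whole line
the weight is a locally bounded sequence of unit blocks with means at most g and unbounded r-th
moments. The blocks are built by iteration: multiply the values by some θ > 1 and alternate copies
with stretches of value 1 that bring the mean back down. Initial and final segments of a block
always satisfy the tangent inequality with β = 1, so pieces can be joined freely. -/

/-! ### The roots of g - log g = Q + 1 and the numbers ε₋, γ₊. -/

theorem log_lt_sub_one_of_one_lt {x : ℝ} (hx : 1 < x) : Real.log x < x - 1 :=
  Real.log_lt_sub_one_of_pos (by linarith) hx.ne'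

theorem strictMonoOn_sub_log : StrictMonoOn (fun g : ℝ => g - Real.log g) (Ici 1) := by
  intro x hx y hy hxy
  have hx : (1 : ℝ) ≤ x := hx
  have h : Real.log (y / x) < y / x - 1 :=
    log_lt_sub_one_of_one_lt ((one_lt_div (by linarith)).2 hxy)
  rw [Real.log_div (by linarith) (by linarith)] at h
  have h2 : y / x - 1 ≤ y - x := by
    rw [div_sub_one (by linarith), div_le_iff₀ (by linarith)]
    nlinarith
  show x - Real.log x < y - Real.log y
  linarith

theorem exists_sub_log_eq {Q : ℝ} (hQ : 0 < Q) : ∃ g : ℝ, 1 < g ∧ g - Real.log g = Q + 1 := by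
  have hc : ContinuousOn (fun g : ℝ => g - Real.log g) (Icc 1 (2 * Q + 4)) :=
    continuousOn_id.sub (Real.continuousOn_log.mono fun x hx => by
      have := hx.1
      simp only [mem_compl_iff, mem_singleton_iff]
      linarith)
  -- Ensures that g - log g exceeds Q + 1 at the right endpoint 2Q + 4 of the bracket.
  have h1 : Real.log (2 * Q + 4) ≤ Q + 2 := by
    have h2 : Real.log (Q + 2) ≤ Q + 2 - 1 := Real.log_le_sub_one_of_pos (by linarith)
    have h3 : Real.log 2 ≤ 2 - 1 := Real.log_le_sub_one_of_pos (by norm_num)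
    rw [show 2 * Q + 4 = 2 * (Q + 2) by ring, Real.log_mul (by norm_num) (by linarith)]
    linarith
  obtain ⟨g, hg, hg'⟩ := intermediate_value_Icc (by linarith) hc
    (show Q + 1 ∈ Icc _ _ from ⟨by simp only [Real.log_one]; linarith, by linarith⟩)
  refine ⟨g, lt_of_le_of_ne hg.1 ?_, hg'⟩
  rintro rfl
  simp at hg'
  linarith

theorem one_div_sub_log_eq_iff {Q t : ℝ} :
    1 / t - Real.log (1 / t + 1) = Q ↔ (1 + 1 / t) - Real.log (1 + 1 / t) = Q + 1 := by
  rw [add_comm (1 / t) 1]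
  constructor <;> intro h <;> linarith

theorem isGammaPlus_of_eq {Q g : ℝ} (hg : 1 < g) (h : g - Real.log g = Q + 1) :
    IsGammaPlus Q g := by
  refine ⟨⟨by linarith, h⟩, ?_⟩
  rintro x ⟨hx0, hx⟩
  rcases le_total x 1 with h1 | h1
  · linarith
  · exact (strictMonoOn_sub_log.injOn (mem_Ici.2 h1) (mem_Ici.2 hg.le) (hx.trans h.symm)).le

theorem isEpsMinus_of_eq {Q g : ℝ} (hg : 1 < g) (h : g - Real.log g = Q + 1) :
    IsEpsMinus Q (1 / (g - 1)) := by
  have hg0 : 0 < g - 1 := by linarith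
  have key : 1 + 1 / (1 / (g - 1)) = g := by rw [one_div_one_div]; ring
  refine ⟨⟨by positivity, one_div_sub_log_eq_iff.2 (by rw [key, h])⟩, ?_⟩
  rintro t ⟨ht0, ht⟩
  rw [one_div_sub_log_eq_iff] at ht
  have h0 : 0 < 1 / t := by positivity
  have := strictMonoOn_sub_log.injOn (mem_Ici.2 (by linarith : (1 : ℝ) ≤ 1 + 1 / t))
    (mem_Ici.2 hg.le) (ht.trans h.symm)
  rw [← this, add_sub_cancel_left, one_div_one_div]

theorem IsEpsMinus.exists_root {Q e : ℝ} (h : IsEpsMinus Q e) :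
    0 < Q ∧ ∃ g : ℝ, 1 < g ∧ g - Real.log g = Q + 1 ∧ e = 1 / (g - 1) := by
  obtain ⟨⟨he, heq⟩, -⟩ := h
  have h0 : 0 < 1 / e := by positivity
  have h1 : Real.log (1 / e + 1) < 1 / e + 1 - 1 := log_lt_sub_one_of_one_lt (by linarith)
  refine ⟨by linarith, 1 + 1 / e, by linarith, one_div_sub_log_eq_iff.1 heq, ?_⟩
  rw [add_sub_cancel_left, one_div_one_div]

theorem IsGammaPlus.eq_of_root {Q g g' : ℝ} (h : IsGammaPlus Q g) (hg : 1 < g')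
    (h' : g' - Real.log g' = Q + 1) : g = g' :=
  IsGreatest.unique h (isGammaPlus_of_eq hg h')

/-! ### Interval averages. -/

theorem setIntegral_Icc_eq_intervalIntegral {f : ℝ → ℝ} {a b : ℝ} (hab : a ≤ b) :
    ∫ x in Icc a b, f x = ∫ x in a..b, f x := by
  rw [intervalIntegral.integral_of_le hab, integral_Icc_eq_integral_Ioc]

theorem intervalMean_eq {f : ℝ → ℝ} {a b : ℝ} (hab : a ≤ b) :
    intervalMean f a b = (b - a)⁻¹ * ∫ x in Icc a b, f x := by
  rw [intervalMean, setAverage_eq]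
  simp [hab]

theorem mul_intervalMean {f : ℝ → ℝ} {a b : ℝ} (hab : a < b) :
    (b - a) * intervalMean f a b = ∫ x in Icc a b, f x := by
  rw [intervalMean_eq hab.le, mul_inv_cancel_left₀ (by linarith)]

theorem intervalMean_pos {w : ℝ → ℝ} {a b : ℝ} (hab : a < b) (hw : IntegrableOn w (Icc a b))
    (hpos : ∀ᵐ x ∂volume.restrict (Icc a b), 0 < w x) : 0 < intervalMean w a b := by
  have h : 0 < ∫ x in Icc a b, w x := by
    refine lt_of_le_of_ne (integral_nonneg_of_ae (hpos.mono fun x hx => hx.le)) fun h0 => ?_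
    have h1 := (integral_eq_zero_iff_of_nonneg_ae (hpos.mono fun x hx => hx.le) hw).1 h0.symm
    have hne : volume.restrict (Icc a b) ≠ 0 := by
      rw [Ne, Measure.restrict_eq_zero, Real.volume_Icc]
      simpa using hab
    have : (ae (volume.restrict (Icc a b))).NeBot := ae_neBot.2 hne
    obtain ⟨x, hx, hx'⟩ := (hpos.and h1).exists
    exact hx.ne' hx'
  rw [intervalMean_eq hab.le]
  have : 0 < b - a := by linarith
  positivity

/-! ### Tangent lines and the entropy condition. -/

/-- The gap between `w log w` and the tangent line, with parameter `β`, to the upper boundary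
`x log x + Q x` of the domain of averages, where `g - log g = Q + 1`. -/
noncomputable def tangentGap (g β w : ℝ) : ℝ := w * Real.log (w / β) - g * (w - β)

theorem integrableOn_mul_log_div {w : ℝ → ℝ} {s : Set ℝ} (hw : IntegrableOn w s)
    (hpos : ∀ᵐ x ∂volume.restrict s, 0 < w x)
    (hlog : IntegrableOn (fun x => w x * Real.log (w x)) s) {β : ℝ} (hβ : 0 < β) :
    IntegrableOn (fun x => w x * Real.log (w x / β)) s := by
  refine (hlog.sub (hw.mul_const (Real.log β))).congr ?_
  filter_upwards [hpos] with x hx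
  simp only [Pi.sub_apply]
  rw [Real.log_div hx.ne' hβ.ne']
  ring

theorem integrableOn_tangentGap {w : ℝ → ℝ} {a b : ℝ} (hw : IntegrableOn w (Icc a b))
    (hpos : ∀ᵐ x ∂volume.restrict (Icc a b), 0 < w x)
    (hlog : IntegrableOn (fun x => w x * Real.log (w x)) (Icc a b)) (g : ℝ) {β : ℝ} (hβ : 0 < β) :
    IntegrableOn (fun x => tangentGap g β (w x)) (Icc a b) :=
  (integrableOn_mul_log_div hw hpos hlog hβ).sub
    ((hw.sub (integrableOn_const (by simp))).const_mul g)

/-- Integrating `tangentGap` against the mean. -/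
theorem integral_tangentGap {w : ℝ → ℝ} {a b : ℝ} (hab : a < b) (hw : IntegrableOn w (Icc a b))
    (hpos : ∀ᵐ x ∂volume.restrict (Icc a b), 0 < w x)
    (hlog : IntegrableOn (fun x => w x * Real.log (w x)) (Icc a b)) (g : ℝ) {β m : ℝ} (hβ : 0 < β)
    (hm : m = intervalMean w a b) :
    ∫ x in Icc a b, tangentGap g β (w x) =
      m * (b - a) * (intervalMean (entropyFun w a b) a b + Real.log (m / β) - g + g * β / m) := by
  have hm0 : 0 < m := hm ▸ intervalMean_pos hab hw hpos
  have h1 : (b - a) * m = ∫ x in Icc a b, w x := hm ▸ mul_intervalMean hab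
  have hE : IntegrableOn (entropyFun w a b) (Icc a b) := by
    have := (integrableOn_mul_log_div hw hpos hlog hm0).const_mul m⁻¹
    refine this.congr (ae_of_all _ fun x => ?_)
    simp only [entropyFun, ← hm]
    ring
  have h2 : (b - a) * intervalMean (entropyFun w a b) a b = ∫ x in Icc a b, entropyFun w a b x :=
    mul_intervalMean hab
  have h3 : ∫ x in Icc a b, tangentGap g β (w x) = ∫ x in Icc a b,
      (m * entropyFun w a b x + (Real.log (m / β) - g) * w x + g * β) := by
    refine integral_congr_ae ?_
    filter_upwards [hpos] with x hx
    simp only [tangentGap, entropyFun, ← hm]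
    rw [Real.log_div hx.ne' hβ.ne', Real.log_div hx.ne' hm0.ne', Real.log_div hm0.ne' hβ.ne']
    field_simp
    ring
  have hi1 : IntegrableOn (fun x => m * entropyFun w a b x) (Icc a b) := hE.const_mul m
  have hi2 : IntegrableOn (fun x => (Real.log (m / β) - g) * w x) (Icc a b) := hw.const_mul _
  have hi3 : IntegrableOn (fun x => m * entropyFun w a b x + (Real.log (m / β) - g) * w x)
      (Icc a b) := hi1.add hi2
  rw [h3, integral_add hi3 (integrableOn_const (by simp)), integral_add hi1 hi2,
    integral_const_mul, integral_const_mul, ← h1, ← h2]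
  simp [hab.le]
  field_simp
  ring

theorem integrableOn_mul_log_of_entropyFun {w : ℝ → ℝ} {a b : ℝ} (hab : a < b)
    (hw : IntegrableOn w (Icc a b)) (hpos : ∀ᵐ x ∂volume.restrict (Icc a b), 0 < w x)
    (hE : IntegrableOn (entropyFun w a b) (Icc a b)) :
    IntegrableOn (fun x => w x * Real.log (w x)) (Icc a b) := by
  have hm0 := intervalMean_pos hab hw hpos
  refine ((hE.const_mul (intervalMean w a b)).add
    (hw.const_mul (Real.log (intervalMean w a b)))).congr ?_
  filter_upwards [hpos] with x hx
  simp only [entropyFun, Pi.add_apply]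
  rw [Real.log_div hx.ne' hm0.ne']
  field_simp
  ring

theorem integrableOn_of_entropyMean_le {w : ℝ → ℝ} {a b Q : ℝ} (h : entropyMean w a b ≤ Q) :
    IntegrableOn (entropyFun w a b) (Icc a b) ∧ intervalMean (entropyFun w a b) a b ≤ Q := by
  rw [entropyMean] at h
  split_ifs at h with h1
  · exact ⟨h1, by exact_mod_cast h⟩
  · simp at h

/-- With β = mean / g the tangent touches the upper boundary exactly above the mean, so there it
coincides with the entropy bound. -/
theorem integral_tangentGap_nonpos {w : ℝ → ℝ} {a b Q g : ℝ} (hab : a < b)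
    (hw : IntegrableOn w (Icc a b)) (hpos : ∀ᵐ x ∂volume.restrict (Icc a b), 0 < w x)
    (hg : 1 < g) (hgQ : g - Real.log g = Q + 1) (h : entropyMean w a b ≤ Q) :
    ∫ x in Icc a b, tangentGap g (intervalMean w a b / g) (w x) ≤ 0 := by
  obtain ⟨hE, hle⟩ := integrableOn_of_entropyMean_le h
  have hm0 := intervalMean_pos hab hw hpos
  have hlog := integrableOn_mul_log_of_entropyFun hab hw hpos hE
  rw [integral_tangentGap hab hw hpos hlog g (by positivity) rfl]
  refine mul_nonpos_of_nonneg_of_nonpos (by have : 0 < b - a := by linarith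
                                            positivity) ?_
  have h1 : intervalMean w a b / (intervalMean w a b / g) = g := by field_simp
  have h2 : g * (intervalMean w a b / g) / intervalMean w a b = 1 := by field_simp
  rw [h1, h2]
  linarith

/-- The upper boundary is convex and lies above each of its tangents, so one arbitrary β > 0
suffices as a certificate. -/
theorem entropyMean_le_of_integral_tangentGap {w : ℝ → ℝ} {a b Q g β : ℝ} (hab : a < b)
    (hw : IntegrableOn w (Icc a b)) (hpos : ∀ᵐ x ∂volume.restrict (Icc a b), 0 < w x)
    (hlog : IntegrableOn (fun x => w x * Real.log (w x)) (Icc a b))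
    (hg : 1 < g) (hgQ : g - Real.log g = Q + 1) (hβ : 0 < β)
    (h : ∫ x in Icc a b, tangentGap g β (w x) ≤ 0) : entropyMean w a b ≤ Q := by
  have hm0 := intervalMean_pos hab hw hpos
  have hE : IntegrableOn (entropyFun w a b) (Icc a b) := by
    have := (integrableOn_mul_log_div hw hpos hlog hm0).const_mul (intervalMean w a b)⁻¹
    refine this.congr (ae_of_all _ fun x => ?_)
    simp only [entropyFun]
    ring
  rw [entropyMean, if_pos hE]
  rw [integral_tangentGap hab hw hpos hlog g hβ rfl] at h
  set m := intervalMean w a b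
  have h1 : intervalMean (entropyFun w a b) a b + Real.log (m / β) - g + g * β / m ≤ 0 := by
    by_contra! hc
    have : 0 < b - a := by linarith
    have := mul_pos (mul_pos hm0 this) hc
    linarith
  -- This is the convexity: equality holds when m = gβ, the point of tangency.
  have h2 : Real.log (g * β / m) ≤ g * β / m - 1 := Real.log_le_sub_one_of_pos (by positivity)
  rw [Real.log_div (by positivity) hm0.ne', Real.log_mul (by linarith) hβ.ne'] at h2
  rw [Real.log_div hm0.ne' hβ.ne'] at h1
  exact_mod_cast (by linarith : intervalMean (entropyFun w a b) a b ≤ Q)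

theorem entropyMean_le_RHOneConst {I : Set ℝ} {w : ℝ → ℝ} {a b : ℝ} (hab : a < b)
    (hI : Icc a b ⊆ I) : entropyMean w a b ≤ RHOneConst I w :=
  le_iSup_of_le a (le_iSup_of_le b (le_iSup_of_le hab (le_iSup_of_le hI le_rfl)))

theorem IsWeightOn.integrableOn_Icc {I : Set ℝ} {w : ℝ → ℝ} (hw : IsWeightOn I w) {a b : ℝ}
    (hI : Icc a b ⊆ I) : IntegrableOn w (Icc a b) :=
  hw.locallyIntegrableOn.integrableOn_compact_subset hI isCompact_Icc

theorem IsWeightOn.ae_pos_Icc {I : Set ℝ} {w : ℝ → ℝ} (hw : IsWeightOn I w) {a b : ℝ}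
    (hI : Icc a b ⊆ I) : ∀ᵐ x ∂volume.restrict (Icc a b), 0 < w x :=
  ae_restrict_of_ae_restrict_of_subset hI hw.ae_pos

/-! ### Rising-sun decomposition at a level above the mean. -/

theorem le_of_forall_Ioc_le {F : ℝ → ℝ} {a b c v : ℝ} (hF : ContinuousOn F (Icc a b))
    (hc : c ∈ Icc a b) (hb : F b ≤ v) (h : ∀ y ∈ Ioc c b, F y ≤ v) : F c ≤ v := by
  rcases hc.2.eq_or_lt with rfl | hcb
  · exact hb
  · have h1 : c ∈ closure (Ioc c b) := by
      rw [closure_Ioc hcb.ne]; exact left_mem_Icc.2 hc.2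
    have h2 : ContinuousWithinAt F (Ioc c b) c :=
      (hF c hc).mono fun y hy => ⟨hc.1.trans hy.1.le, hy.2⟩
    have := h2.closure_le h1 continuousWithinAt_const h
    exact this

/-- The components of the set that the rising sun leaves in the shade. -/
theorem exists_shadow_intervals {F : ℝ → ℝ} {a b : ℝ} (hab : a < b)
    (hF : ContinuousOn F (Icc a b)) (ha : F a = 0) (hb : F b ≤ 0) :
    ∃ (V Z : Set ℝ) (p q : ℝ → ℝ), V.Countable ∧ Z.Countable ∧
      (∀ v ∈ V, a ≤ p v ∧ p v < q v ∧ q v ≤ b ∧ F (p v) = F (q v)) ∧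
      V.PairwiseDisjoint (fun v => Ioo (p v) (q v)) ∧
      ∀ x ∈ Icc a b, x ∉ Z → (∀ v ∈ V, x ∉ Ioo (p v) (q v)) →
        x < b ∧ F x < 0 ∧ ∀ y ∈ Icc x b, F y < 0 → F y ≤ F x := by
  -- The points p v and q v are the ends of the plateau at height v of x ↦ min (sup of F on [x, b],
  -- 0). The clause v < 0 reduces `U 0` to {a}, so the plateau at height 0 starts at a; this is what
  -- gives F equal values at the two ends of the first interval too.
  set A : ℝ → Set ℝ := fun v => {y | y ∈ Icc a b ∧ v ≤ F y}
  set U : ℝ → Set ℝ := fun v => insert a {y | y ∈ Icc a b ∧ v < F y ∧ v < 0}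
  set q : ℝ → ℝ := fun v => sSup (A v)
  set p : ℝ → ℝ := fun v => sSup (U v)
  have haI : a ∈ Icc a b := left_mem_Icc.2 hab.le
  have hAcl : ∀ v, IsClosed (A v) := fun v =>
    hF.preimage_isClosed_of_isClosed isClosed_Icc isClosed_Ici
  have hAbdd : ∀ v, BddAbove (A v) := fun v => ⟨b, fun y hy => hy.1.2⟩
  have hUbdd : ∀ v, BddAbove (U v) := fun v => ⟨b, by
    rintro y (rfl | hy)
    exacts [hab.le, hy.1.2]⟩
  have hUsub : ∀ v, v ≤ 0 → U v ⊆ A v := by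
    rintro v hv y (rfl | hy)
    · exact ⟨haI, by rw [ha]; exact hv⟩
    · exact ⟨hy.1, hy.2.1.le⟩
  have hUne : ∀ v, (U v).Nonempty := fun v => ⟨a, mem_insert _ _⟩
  have hqA : ∀ v ≤ 0, q v ∈ A v := fun v hv =>
    (hAcl v).csSup_mem ((hUne v).mono (hUsub v hv)) (hAbdd v)
  have hpA : ∀ v ≤ 0, p v ∈ A v := fun v hv =>
    closure_minimal (hUsub v hv) (hAcl v) (csSup_mem_closure (hUne v) (hUbdd v))
  have hFq : ∀ v, F b ≤ v → v ≤ 0 → F (q v) = v := by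
    intro v hbv hv
    refine le_antisymm (le_of_forall_Ioc_le hF (hqA v hv).1 hbv fun y hy => ?_) (hqA v hv).2
    by_contra! hc
    exact absurd (le_csSup (hAbdd v) ⟨⟨(hqA v hv).1.1.trans hy.1.le, hy.2⟩, hc.le⟩) (not_le.2 hy.1)
  have hFp : ∀ v, F b ≤ v → v ≤ 0 → F (p v) = v := by
    intro v hbv hv
    rcases hv.eq_or_lt with rfl | hv0
    · have : p 0 = a := by
        have : U 0 = {a} := by
          ext y
          simp [U]
        simp [p, this]
      rw [this, ha]
    refine le_antisymm (le_of_forall_Ioc_le hF (hpA v hv).1 hbv fun y hy => ?_) (hpA v hv).2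
    by_contra! hc
    exact absurd (le_csSup (hUbdd v) (mem_insert_of_mem _
      ⟨⟨(hpA v hv).1.1.trans hy.1.le, hy.2⟩, hc, hv0⟩)) (not_le.2 hy.1)
  set V : Set ℝ := {v | F b ≤ v ∧ v ≤ 0 ∧ p v < q v}
  have hdisj : V.PairwiseDisjoint (fun v => Ioo (p v) (q v)) := by
    have key : ∀ u ∈ V, ∀ v ∈ V, u < v → Disjoint (Ioo (p u) (q u)) (Ioo (p v) (q v)) := by
      intro u hu v hv huv
      have : q v ≤ p u := le_csSup (hUbdd u) (mem_insert_of_mem _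
        ⟨(hqA v hv.2.1).1, by rw [hFq v hv.1 hv.2.1]; exact huv, huv.trans_le hv.2.1⟩)
      rw [Set.disjoint_left]
      intro x hx hx'
      linarith [hx.1, hx'.2]
    intro u hu v hv huv
    rcases lt_or_gt_of_ne huv with h | h
    · exact key u hu v hv h
    · exact (key v hv u hu h).symm
  have hVc : V.Countable := hdisj.countable_of_isOpen (fun _ _ => isOpen_Ioo)
    fun v hv => nonempty_Ioo.2 hv.2.2
  refine ⟨V, {a, b} ∪ (p '' V ∪ q '' V), p, q, hVc,
    (Set.toFinite _).countable.union ((hVc.image p).union (hVc.image q)),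
    fun v hv => ⟨(hpA v hv.2.1).1.1, hv.2.2, (hqA v hv.2.1).1.2, ?_⟩, hdisj, ?_⟩
  · rw [hFp v hv.1 hv.2.1, hFq v hv.1 hv.2.1]
  intro x hx hxZ hxV
  simp only [mem_union, mem_insert_iff, mem_singleton_iff, not_or] at hxZ
  have hnot : ∀ v, F b ≤ v → v ≤ 0 → p v ≤ x → x ≤ q v → p v < q v → False := by
    intro v h1 h2 h3 h4 h5
    have hv : v ∈ V := ⟨h1, h2, h5⟩
    exact hxV v hv ⟨lt_of_le_of_ne h3 fun h => hxZ.2.1 ⟨v, hv, h⟩,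
      lt_of_le_of_ne h4 fun h => hxZ.2.2 ⟨v, hv, h.symm⟩⟩
  have hxa : a < x := lt_of_le_of_ne hx.1 fun h => hxZ.1.1 h.symm
  have hFx : F x < 0 := by
    by_contra! hc
    have hp0 : p 0 = a := by
      have : U 0 = {a} := by
        ext y
        simp [U]
      simp [p, this]
    have hq0 : x ≤ q 0 := le_csSup (hAbdd 0) ⟨hx, hc⟩
    exact hnot 0 hb le_rfl (hp0.le.trans hx.1) hq0 (by rw [hp0]; linarith)
  refine ⟨lt_of_le_of_ne hx.2 hxZ.1.2, hFx, fun y hy hFy => ?_⟩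
  by_contra! hc
  -- The height of the plateau containing x is the maximum of min (F, 0) over [x, b]. It is attained
  -- to the right of x and exceeds F x, so x would lie in an interval that was excluded.
  obtain ⟨z, hz, hzmax⟩ := isCompact_Icc.exists_isMaxOn (nonempty_Icc.2 hx.2)
    (((hF.mono (Icc_subset_Icc_left hx.1)).inf continuousOn_const :
      ContinuousOn (fun t => min (F t) 0) (Icc x b)))
  have hzmax' : ∀ t ∈ Icc x b, min (F t) 0 ≤ min (F z) 0 := hzmax
  set v := min (F z) 0
  have hxv : F x < v := hc.trans_le (by simpa [min_eq_left hFy.le] using hzmax' y hy)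
  have hbv : F b ≤ v := by simpa [min_eq_left hb] using hzmax' b ⟨hx.2, le_rfl⟩
  have hxz : x < z := lt_of_le_of_ne hz.1 (by
    rintro rfl
    exact absurd (min_le_left (F x) 0) (not_le.2 hxv))
  have hzq : z ≤ q v := le_csSup (hAbdd v) ⟨⟨hx.1.trans hz.1, hz.2⟩, min_le_left _ _⟩
  have hpx : p v ≤ x := by
    refine csSup_le (hUne v) ?_
    rintro u (rfl | hu)
    · exact hx.1
    · by_contra! hxu
      exact absurd (hzmax' u ⟨hxu.le, hu.1.2⟩) (not_le.2 (lt_min hu.2.1 hu.2.2))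
  exact hnot v hbv (min_le_right _ _) hpx (hxz.le.trans hzq) (by linarith)

/-- One-dimensional Calderon-Zygmund decomposition at a level `l` above the average: the good set
is covered by intervals on which the average of `w` is exactly `l`. -/
theorem exists_shadow_set {w k : ℝ → ℝ} {a b l : ℝ} (hab : a < b)
    (hw : IntegrableOn w (Icc a b)) (hk : IntegrableOn k (Icc a b))
    (hmean : ∫ x in Icc a b, w x ≤ l * (b - a))
    (hyp : ∀ c d, a ≤ c → c < d → d ≤ b → ∫ x in Icc c d, w x = l * (d - c) →
      ∫ x in Icc c d, k x ≤ 0) :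
    ∃ E ⊆ Icc a b, MeasurableSet E ∧ ∫ x in E, k x ≤ 0 ∧
      ∀ᵐ x ∂volume.restrict (Icc a b), x ∉ E → w x ≤ l := by
  set f : ℝ → ℝ := fun x => w x - l
  have hf : IntegrableOn f (Icc a b) := hw.sub (integrableOn_const (by simp))
  set F : ℝ → ℝ := fun x => ∫ t in a..x, f t
  have hfi : IntervalIntegrable f volume a b :=
    (intervalIntegrable_iff_integrableOn_Icc_of_le hab.le).2 hf
  have hwi : IntervalIntegrable w volume a b :=
    (intervalIntegrable_iff_integrableOn_Icc_of_le hab.le).2 hw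
  have hFc : ContinuousOn F (Icc a b) := by
    have := intervalIntegral.continuousOn_primitive_interval (a := a) (b := b) (f := f)
      (μ := volume) (by rwa [uIcc_of_le hab.le])
    rwa [uIcc_of_le hab.le] at this
  have hsub : ∀ c d, c ∈ Icc a b → d ∈ Icc a b → F d - F c = (∫ x in c..d, w x) - l * (d - c) := by
    intro c d hc hd
    have h1 : ∀ x ∈ Icc a b, uIcc a x ⊆ uIcc a b := fun x hx => by
      rw [uIcc_of_le hx.1, uIcc_of_le hab.le]
      exact Icc_subset_Icc_right hx.2
    have h2 : uIcc c d ⊆ uIcc a b := by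
      rw [uIcc_of_le hab.le]; exact uIcc_subset_Icc hc hd
    rw [intervalIntegral.integral_interval_sub_left (hfi.mono_set (h1 d hd))
      (hfi.mono_set (h1 c hc)), intervalIntegral.integral_sub (hwi.mono_set h2) (by simp)]
    simp
    ring
  have haI : a ∈ Icc a b := left_mem_Icc.2 hab.le
  have hF0 : F a = 0 := by simp [F]
  have hFb : F b ≤ 0 := by
    have := hsub a b haI (right_mem_Icc.2 hab.le)
    rw [hF0, ← setIntegral_Icc_eq_intervalIntegral hab.le] at this
    linarith
  obtain ⟨V, Z, p, q, hV, hZ, hpq, hdisj, hout⟩ := exists_shadow_intervals hab hFc hF0 hFb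
  have hE : (⋃ v : V, Ioo (p v) (q v)) ⊆ Icc a b := iUnion_subset fun v x hx =>
    ⟨(hpq v v.2).1.trans hx.1.le, hx.2.le.trans (hpq v v.2).2.2.1⟩
  have : Countable V := hV.to_subtype
  refine ⟨⋃ v : V, Ioo (p v) (q v), hE, MeasurableSet.iUnion fun v => measurableSet_Ioo, ?_, ?_⟩
  · have hsum := hasSum_integral_iUnion (fun v : V => measurableSet_Ioo (a := p v) (b := q v))
      (fun u v huv => hdisj u.2 v.2 fun h => huv (Subtype.ext h)) (hk.mono_set hE)
    refine hasSum_le (fun v => ?_) hsum (hasSum_zero (α := ℝ))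
    obtain ⟨h1, h2, h3, h4⟩ := hpq v v.2
    rw [← integral_Icc_eq_integral_Ioo]
    refine hyp _ _ h1 h2 h3 ?_
    have := hsub (p v) (q v) ⟨h1, h2.le.trans h3⟩ ⟨h1.trans h2.le, h3⟩
    rw [setIntegral_Icc_eq_intervalIntegral h2.le]
    linarith
  · have hZ0 : ∀ᵐ x ∂volume, x ∉ Z := measure_eq_zero_iff_ae_notMem.1 (hZ.measure_zero volume)
    rw [ae_restrict_iff' measurableSet_Icc]
    filter_upwards [hfi.ae_hasDerivAt_integral, hZ0] with x hx hxZ hxI hxE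
    have hd := hx (by rwa [uIcc_of_le hab.le]) a (by rw [uIcc_of_le hab.le]; exact haI)
    obtain ⟨hxb, hFx, hle⟩ := hout x hxI hxZ fun v hv hxv => hxE (mem_iUnion.2 ⟨⟨v, hv⟩, hxv⟩)
    by_contra! hc
    -- If w x > l, then F has positive derivative at x, so just to the right it exceeds F x while
    -- still negative, against `hle`.
    have hslope := (hasDerivWithinAt_iff_tendsto_slope' self_notMem_Ioi).1
      (hd.hasDerivWithinAt (s := Ioi x))
    have h1 := hslope.eventually (lt_mem_nhds (by simp only [f]; linarith : (0 : ℝ) < f x))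
    have h2 : ∀ᶠ y in nhdsWithin x (Ioi x), F y < 0 :=
      (hd.continuousAt.continuousWithinAt.tendsto).eventually (gt_mem_nhds hFx)
    have h3 : ∀ᶠ y in nhdsWithin x (Ioi x), y ∈ Ioc x b := Ioc_mem_nhdsGT hxb
    obtain ⟨y, hy1, hy2, hy3⟩ := (h1.and (h2.and h3)).exists
    have h4 := hle y ⟨hy3.1.le, hy3.2⟩ hy2
    rw [slope_def_field] at hy1
    have h5 : 0 < y - x := by linarith [hy3.1]
    rw [lt_div_iff₀ h5] at hy1
    simp only [F] at h4
    linarith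

/-! ### The level set inequality. -/

/-- The part of `tangentGap g β` above the level `β`. -/
noncomputable def posGap (g β w : ℝ) : ℝ := if β < w then tangentGap g β w else 0

theorem measurable_tangentGap (g : ℝ) : Measurable fun z : ℝ × ℝ => tangentGap g z.2 z.1 := by
  unfold tangentGap
  fun_prop

theorem measurable_posGap (g : ℝ) : Measurable fun z : ℝ × ℝ => posGap g z.2 z.1 :=
  (measurable_tangentGap g).ite (measurableSet_lt measurable_snd measurable_fst) measurable_const

theorem tangentGap_nonpos {g β w : ℝ} (hβ : 0 < β) (h1 : β ≤ w) (h2 : w ≤ g * β) :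
    tangentGap g β w ≤ 0 := by
  have hw : 0 < w := hβ.trans_le h1
  have h3 : Real.log (w / β) ≤ w / β - 1 := Real.log_le_sub_one_of_pos (by positivity)
  have h4 : w / β ≤ g := (div_le_iff₀ hβ).2 h2
  have h5 : w * Real.log (w / β) ≤ w * (w / β - 1) := mul_le_mul_of_nonneg_left h3 hw.le
  have h6 : w * (w / β - 1) = w / β * (w - β) := by field_simp
  have h7 : w / β * (w - β) ≤ g * (w - β) := mul_le_mul_of_nonneg_right h4 (by linarith)
  unfold tangentGap
  linarith

theorem tangentGap_nonneg_of_le {g β w : ℝ} (hg : 1 ≤ g) (hw : 0 < w) (h1 : w ≤ β) :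
    0 ≤ tangentGap g β w := by
  have hβ : 0 < β := hw.trans_le h1
  have h3 : 1 - (w / β)⁻¹ ≤ Real.log (w / β) := Real.one_sub_inv_le_log_of_pos (by positivity)
  have h5 : w * (1 - (w / β)⁻¹) ≤ w * Real.log (w / β) := mul_le_mul_of_nonneg_left h3 hw.le
  have h6 : w * (1 - (w / β)⁻¹) = w - β := by field_simp
  unfold tangentGap
  nlinarith

theorem integrableOn_posGap {w : ℝ → ℝ} {a b g β : ℝ} (hβ : 0 < β) (hw : IntegrableOn w (Icc a b))
    (hpos : ∀ᵐ x ∂volume.restrict (Icc a b), 0 < w x)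
    (hlog : IntegrableOn (fun x => w x * Real.log (w x)) (Icc a b)) :
    IntegrableOn (fun x => posGap g β (w x)) (Icc a b) := by
  refine Integrable.mono (integrableOn_tangentGap hw hpos hlog g hβ) ?_ (ae_of_all _ fun x => ?_)
  · exact ((measurable_posGap g).comp_aemeasurable
      (hw.aemeasurable.prodMk aemeasurable_const)).aestronglyMeasurable
  · rw [posGap]
    split_ifs
    · exact le_rfl
    · simp

/-- The level set inequality at every level above `1 / g` times the average. -/
theorem integral_posGap_nonpos {w : ℝ → ℝ} {a b Q g β : ℝ} (hab : a < b)
    (hw : IntegrableOn w (Icc a b)) (hpos : ∀ᵐ x ∂volume.restrict (Icc a b), 0 < w x)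
    (hlog : IntegrableOn (fun x => w x * Real.log (w x)) (Icc a b))
    (hg : 1 < g) (hgQ : g - Real.log g = Q + 1)
    (hQ : ∀ c d, a ≤ c → c < d → d ≤ b → entropyMean w c d ≤ Q)
    (hβ : 0 < β) (hm : intervalMean w a b ≤ g * β) :
    ∫ x in Icc a b, posGap g β (w x) ≤ 0 := by
  have hk := integrableOn_tangentGap hw hpos hlog g hβ
  have hmean : ∫ x in Icc a b, w x ≤ g * β * (b - a) := by
    rw [← mul_intervalMean hab, mul_comm]
    exact mul_le_mul_of_nonneg_right hm (by linarith)
  obtain ⟨E, hE, hEm, hEk, hEl⟩ := exists_shadow_set hab hw hk hmean (by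
    intro c d hac hcd hdb hcw
    have hsub : Icc c d ⊆ Icc a b := Icc_subset_Icc hac hdb
    have := integral_tangentGap_nonpos hcd (hw.mono_set hsub)
      (ae_restrict_of_ae_restrict_of_subset hsub hpos) hg hgQ (hQ c d hac hcd hdb)
    have hmm : intervalMean w c d / g = β := by
      rw [intervalMean_eq hcd.le, hcw]
      have : d - c ≠ 0 := by linarith
      field_simp
    rwa [hmm] at this)
  calc ∫ x in Icc a b, posGap g β (w x)
      ≤ ∫ x in Icc a b, E.indicator (fun x => tangentGap g β (w x)) x := by
        refine integral_mono_ae (integrableOn_posGap hβ hw hpos hlog) (hk.indicator hEm) ?_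
        -- On E, dropping the values w ≤ β only discards a nonnegative gap. Off E, a value above β
        -- is at most gβ, where the gap is nonpositive.
        filter_upwards [hpos, hEl] with x hx hxl
        by_cases hxE : x ∈ E
        · simp only [indicator_of_mem hxE, posGap]
          split_ifs with h
          · exact le_rfl
          · exact tangentGap_nonneg_of_le hg.le hx (not_lt.1 h)
        · simp only [indicator_of_notMem hxE, posGap]
          split_ifs with h
          · exact tangentGap_nonpos hβ h.le (hxl hxE)
          · exact le_rfl
    _ = ∫ x in E, tangentGap g β (w x) := by
        rw [setIntegral_indicator hEm, inter_eq_self_of_subset_right hE]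
    _ ≤ 0 := hEk

/-! ### Integration over the levels and higher integrability. -/

/-- An antiderivative in `β` of `β ^ (ε - 1) * tangentGap g β w`. -/
noncomputable def gapPrimitive (g ε w β : ℝ) : ℝ :=
  w * (β ^ ε * Real.log (w / β) / ε + β ^ ε / ε ^ 2) - g * (w * β ^ ε / ε - β ^ (1 + ε) / (1 + ε))

theorem hasDerivAt_gapPrimitive {g ε w β : ℝ} (hε : 0 < ε) (hw : 0 < w) (hβ : 0 < β) :
    HasDerivAt (gapPrimitive g ε w) (β ^ (ε - 1) * tangentGap g β w) β := by
  have h1 : HasDerivAt (fun β : ℝ => β ^ ε) (ε * β ^ (ε - 1)) β :=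
    Real.hasDerivAt_rpow_const (Or.inl hβ.ne')
  have h2 : HasDerivAt (fun β : ℝ => β ^ (1 + ε)) ((1 + ε) * β ^ (1 + ε - 1)) β :=
    Real.hasDerivAt_rpow_const (Or.inl hβ.ne')
  have h3 : HasDerivAt (fun β : ℝ => Real.log (w / β)) (-β⁻¹) β := by
    have : HasDerivAt (fun β : ℝ => Real.log w - Real.log β) (-β⁻¹) β :=
      (Real.hasDerivAt_log hβ.ne').const_sub _
    refine this.congr_of_eventuallyEq ?_
    filter_upwards [lt_mem_nhds hβ] with y hy
    rw [Real.log_div hw.ne' hy.ne']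
  have h := ((((h1.mul h3).div_const ε).add (h1.div_const (ε ^ 2))).const_mul w).sub
    ((((h1.const_mul w).div_const ε).sub (h2.div_const (1 + ε))).const_mul g)
  refine h.congr_deriv ?_
  have e1 : β ^ (1 + ε - 1) = β ^ (ε - 1) * β := by
    rw [← Real.rpow_add_one hβ.ne']; ring_nf
  have e2 : β ^ ε = β ^ (ε - 1) * β := by
    rw [← Real.rpow_add_one hβ.ne']; ring_nf
  rw [e1, e2]
  unfold tangentGap
  have : 1 + ε ≠ 0 := by linarith
  field_simp
  ring

/-- With u = w / v, the difference of the two sides is a positive factor times u log u - u + 1 + (u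
- 1)(1/ε - g + 1), and both parts are nonnegative for u ≥ 1. Equality holds at w = v; the case w > v
occurs when w is truncated. -/
theorem le_gapPrimitive {g ε w v : ℝ} (hε : 0 < ε) (hgε : ε * (g - 1) < 1) (hv : 0 < v)
    (hvw : v ≤ w) :
    (1 / ε ^ 2 - g / (ε * (1 + ε))) * v ^ (1 + ε) ≤ gapPrimitive g ε w v := by
  set u := w / v with hu
  have hu1 : 1 ≤ u := (one_le_div hv).2 hvw
  have hw : w = u * v := by rw [hu]; field_simp
  have e1 : v ^ (1 + ε) = v ^ ε * v := by rw [add_comm, Real.rpow_add_one hv.ne']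
  have hve : 0 < v ^ ε := Real.rpow_pos_of_pos hv ε
  have key : gapPrimitive g ε w v - (1 / ε ^ 2 - g / (ε * (1 + ε))) * v ^ (1 + ε) =
      v ^ ε * v / ε * (u * Real.log u - u + 1 + (u - 1) * (1 / ε - g + 1)) := by
    unfold gapPrimitive
    rw [← hu, e1, hw]
    have : 1 + ε ≠ 0 := by linarith
    field_simp
    ring
  have h1 : 1 - u⁻¹ ≤ Real.log u := Real.one_sub_inv_le_log_of_pos (by linarith)
  have h2 : u * (1 - u⁻¹) ≤ u * Real.log u := mul_le_mul_of_nonneg_left h1 (by linarith)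
  have h3 : u * (1 - u⁻¹) = u - 1 := by field_simp
  have h4 : 0 ≤ 1 / ε - g + 1 := by
    have : g - 1 < 1 / ε := by rw [lt_div_iff₀ hε]; linarith
    linarith
  have h5 : 0 ≤ v ^ ε * v / ε * (u * Real.log u - u + 1 + (u - 1) * (1 / ε - g + 1)) := by
    have : 0 ≤ (u - 1) * (1 / ε - g + 1) := mul_nonneg (by linarith) h4
    refine mul_nonneg (by positivity) (by linarith)
  linarith

/-- A lower bound for the superposition of the level set functions. -/
theorem le_integral_rpow_mul_posGap {g ε w β N : ℝ} (hg : 0 < g) (hε : 0 < ε)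
    (hgε : ε * (g - 1) < 1) (hw : 0 < w) (hβ : 0 < β) (hN : β < N) {c : ℝ}
    (hc : c = 1 / ε ^ 2 - g / (ε * (1 + ε))) (hc0 : 0 < c) :
    c * min w N ^ (1 + ε) - (β ^ ε * ((posGap g β w + g * w) / ε + w / ε ^ 2) +
      (g + c) * β ^ (1 + ε)) ≤ ∫ t in Ioc β N, t ^ (ε - 1) * posGap g t w := by
  have hβε : 0 < β ^ ε := Real.rpow_pos_of_pos hβ ε
  have hβε' : 0 < β ^ (1 + ε) := Real.rpow_pos_of_pos hβ _
  rcases le_or_gt w β with hwβ | hwβ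
  · have h0 : ∫ t in Ioc β N, t ^ (ε - 1) * posGap g t w = 0 := by
      rw [setIntegral_congr_fun (g := fun _ => (0 : ℝ)) measurableSet_Ioc fun t ht => ?_]
      · simp
      · simp only [posGap]
        rw [if_neg (by linarith [ht.1]), mul_zero]
    have h1 : min w N ^ (1 + ε) ≤ β ^ (1 + ε) :=
      Real.rpow_le_rpow (le_min hw.le (hβ.trans hN).le) ((min_le_left _ _).trans hwβ) (by linarith)
    have h2 : posGap g β w = 0 := by rw [posGap, if_neg (not_lt.2 hwβ)]
    rw [h0, h2]
    have h3 : 0 ≤ β ^ ε * ((0 + g * w) / ε + w / ε ^ 2) := by positivity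
    have h4 : c * min w N ^ (1 + ε) ≤ c * β ^ (1 + ε) := mul_le_mul_of_nonneg_left h1 hc0.le
    have h5 : 0 < g * β ^ (1 + ε) := by positivity
    linarith
  · set v := min w N
    have hvβ : β < v := lt_min hwβ hN
    have h0 : ∫ t in Ioc β N, t ^ (ε - 1) * posGap g t w =
        ∫ t in Ioc β v, t ^ (ε - 1) * tangentGap g t w := by
      rw [setIntegral_eq_of_subset_of_forall_sdiff_eq_zero measurableSet_Ioc
        (Ioc_subset_Ioc_right (min_le_right w N) : Ioc β v ⊆ Ioc β N)]
      · refine setIntegral_congr_fun measurableSet_Ioc fun t ht => ?_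
        simp only [posGap]
        split_ifs with h
        · rfl
        -- At the endpoint t = w the strict inequality in `posGap` fails, but the gap vanishes there
        -- as well.
        · have : t = w := le_antisymm (ht.2.trans (min_le_left _ _)) (not_lt.1 h)
          rw [this, tangentGap, div_self hw.ne']
          simp
      · intro t ht
        have : ¬ t < w := fun h => ht.2 ⟨ht.1.1, le_min h.le ht.1.2⟩
        simp [posGap, this]
    have hder : ∀ t ∈ uIcc β v, HasDerivAt (gapPrimitive g ε w) (t ^ (ε - 1) * tangentGap g t w)
        t := fun t ht => hasDerivAt_gapPrimitive hε hw (by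
          rw [uIcc_of_le hvβ.le] at ht; exact hβ.trans_le ht.1)
    have hcont : ContinuousOn (fun t => t ^ (ε - 1) * tangentGap g t w) (uIcc β v) := by
      have hne : ∀ t ∈ uIcc β v, t ≠ 0 := fun t ht => by
        rw [uIcc_of_le hvβ.le] at ht; exact (hβ.trans_le ht.1).ne'
      unfold tangentGap
      refine (continuousOn_id.rpow_const fun t ht => Or.inl (hne t ht)).mul ?_
      refine (continuousOn_const.mul ((continuousOn_const.div continuousOn_id hne).log
        fun t ht => div_ne_zero hw.ne' (hne t ht))).sub (by fun_prop)
    rw [h0, ← intervalIntegral.integral_of_le hvβ.le,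
      intervalIntegral.integral_eq_sub_of_hasDerivAt hder hcont.intervalIntegrable]
    have h1 := le_gapPrimitive hε hgε (hβ.trans hvβ) (min_le_left w N : v ≤ w)
    rw [← hc] at h1
    -- The term w log (w / β) is kept inside `posGap g β w`, whose integral is nonpositive, so no
    -- entropy term survives in the final bound.
    have h2 : gapPrimitive g ε w β ≤
        β ^ ε * ((posGap g β w + g * w) / ε + w / ε ^ 2) + g * β ^ (1 + ε) := by
      have e1 : β ^ (1 + ε) = β ^ ε * β := by rw [add_comm, Real.rpow_add_one hβ.ne']
      have : β ^ ε * ((posGap g β w + g * w) / ε + w / ε ^ 2) + g * β ^ (1 + ε) -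
          gapPrimitive g ε w β = β ^ ε * (g * β * (1 / ε + ε / (1 + ε)) + g * w / ε) := by
        rw [posGap, if_pos hwβ]
        unfold gapPrimitive tangentGap
        rw [e1]
        have : 1 + ε ≠ 0 := by linarith
        field_simp
        ring
      have : 0 ≤ β ^ ε * (g * β * (1 / ε + ε / (1 + ε)) + g * w / ε) := by positivity
      linarith
    have h5 : 0 < c * β ^ (1 + ε) := by positivity
    linarith

/-- Fubini turns the level set inequalities for β < t ≤ N into a bound on the truncated moment. The
right-hand side does not involve N, so the truncation can be removed afterwards. -/
theorem integral_min_rpow_le {w : ℝ → ℝ} {a b Q g ε N : ℝ} (hab : a < b)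
    (hw : IntegrableOn w (Icc a b)) (hpos : ∀ᵐ x ∂volume.restrict (Icc a b), 0 < w x)
    (hg : 1 < g) (hgQ : g - Real.log g = Q + 1)
    (hQ : ∀ c d, a ≤ c → c < d → d ≤ b → entropyMean w c d ≤ Q) (hε : 0 < ε)
    (hgε : ε * (g - 1) < 1) {β : ℝ} (hβ : β = intervalMean w a b / g) (hN : β < N) {c : ℝ}
    (hc : c = 1 / ε ^ 2 - g / (ε * (1 + ε))) (hc0 : 0 < c) :
    c * ∫ x in Icc a b, min (w x) N ^ (1 + ε) ≤
      (b - a) * β ^ (1 + ε) * (g ^ 2 / ε + g / ε ^ 2 + g + c) := by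
  have hm0 := intervalMean_pos hab hw hpos
  have hβ0 : 0 < β := by rw [hβ]; positivity
  have hlog := integrableOn_mul_log_of_entropyFun hab hw hpos
    (integrableOn_of_entropyMean_le (hQ a b le_rfl hab le_rfl)).1
  have hgβ : g * β = intervalMean w a b := by rw [hβ]; field_simp
  have hlev : ∀ t, β ≤ t → ∫ x in Icc a b, posGap g t (w x) ≤ 0 := fun t ht =>
    integral_posGap_nonpos hab hw hpos hlog hg hgQ hQ (hβ0.trans_le ht) (by
      rw [← hgβ]; exact mul_le_mul_of_nonneg_left ht (by linarith))
  set μ := volume.restrict (Icc a b)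
  set ν := volume.restrict (Ioc β N)
  have hpg : IntegrableOn (fun x => posGap g β (w x)) (Icc a b) :=
    integrableOn_posGap hβ0 hw hpos hlog
  -- For t > β the gap is dominated by |w log (w / β)| + g |w|, free of t and integrable because the
  -- entropy is finite.
  have hprod : Integrable (Function.uncurry fun x t => t ^ (ε - 1) * posGap g t (w x))
      (μ.prod ν) := by
    have hG : Integrable (fun x => |w x * Real.log (w x / β)| + g * |w x|) μ :=
      (integrableOn_mul_log_div hw hpos hlog hβ0).abs.add (hw.abs.const_mul g)
    have hr : Integrable (fun t : ℝ => t ^ (ε - 1)) ν := by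
      have : ContinuousOn (fun t : ℝ => t ^ (ε - 1)) (Icc β N) :=
        continuousOn_id.rpow_const fun t ht => Or.inl (hβ0.trans_le ht.1).ne'
      exact this.integrableOn_Icc.mono_set Ioc_subset_Icc_self
    have hpos2 : ∀ᵐ z ∂μ.prod ν, 0 < w z.1 ∧ β < z.2 := by
      have h1 : ∀ᵐ z ∂μ.prod ν, 0 < w z.1 := Measure.quasiMeasurePreserving_fst.ae hpos
      have h2 : ∀ᵐ z ∂μ.prod ν, z.2 ∈ Ioc β N :=
        Measure.quasiMeasurePreserving_snd.ae (ae_restrict_mem measurableSet_Ioc)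
      filter_upwards [h1, h2] with z hz1 hz2 using ⟨hz1, hz2.1⟩
    refine (hG.mul_prod hr).mono' ?_ ?_
    · have hm : Measurable fun z : ℝ × ℝ => z.2 ^ (ε - 1) * posGap g z.2 z.1 :=
        (measurable_snd.pow_const _).mul (measurable_posGap g)
      exact (hm.comp_aemeasurable
        (hw.aemeasurable.comp_fst.prodMk measurable_snd.aemeasurable)).aestronglyMeasurable
    · filter_upwards [hpos2] with z hz
      have hz2 : 0 < z.2 := hβ0.trans hz.2
      simp only [Function.uncurry]
      rw [norm_mul, mul_comm, Real.norm_of_nonneg (Real.rpow_nonneg hz2.le _)]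
      refine mul_le_mul_of_nonneg_right ?_ (Real.rpow_nonneg hz2.le _)
      rw [posGap]
      split_ifs with h
      · rw [tangentGap, Real.norm_eq_abs]
        have hlog0 : 0 ≤ Real.log (w z.1 / z.2) := Real.log_nonneg ((one_le_div hz2).2 h.le)
        have hlog1 : Real.log (w z.1 / z.2) ≤ Real.log (w z.1 / β) :=
          Real.log_le_log (div_pos hz.1 hz2) (div_le_div_of_nonneg_left hz.1.le hβ0 hz.2.le)
        have h1 := mul_le_mul_of_nonneg_left hlog1 hz.1.le
        have h2 := mul_nonneg hz.1.le hlog0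
        have h3 : 0 ≤ g * (w z.1 - z.2) := mul_nonneg (by linarith) (by linarith)
        have h4 : 0 ≤ g * z.2 := by positivity
        have h5 : 0 ≤ g * w z.1 := mul_nonneg (by linarith) hz.1.le
        rw [abs_of_pos hz.1, abs_of_nonneg (h2.trans h1)]
        refine abs_le.2 ⟨?_, ?_⟩ <;> nlinarith
      · rw [norm_zero]
        have : 0 < g := by linarith
        positivity
  have hswap : ∫ x, (∫ t, t ^ (ε - 1) * posGap g t (w x) ∂ν) ∂μ ≤ 0 := by
    rw [integral_integral_swap hprod]
    refine integral_nonpos_of_ae ?_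
    filter_upwards [ae_restrict_mem (μ := volume) (measurableSet_Ioc (a := β) (b := N))] with t ht
    rw [integral_const_mul]
    exact mul_nonpos_of_nonneg_of_nonpos (Real.rpow_nonneg (hβ0.trans ht.1).le _) (hlev t ht.1.le)
  set B : ℝ → ℝ := fun x => β ^ ε * ((posGap g β (w x) + g * w x) / ε + w x / ε ^ 2) +
      (g + c) * β ^ (1 + ε)
  have hpw : Integrable (fun x => (posGap g β (w x) + g * w x) / ε) μ :=
    (hpg.add (hw.const_mul g)).div_const ε
  have hpw2 : Integrable (fun x => (posGap g β (w x) + g * w x) / ε + w x / ε ^ 2) μ :=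
    hpw.add (hw.div_const _)
  have hconst : Integrable (fun _ : ℝ => (g + c) * β ^ (1 + ε)) μ := integrable_const _
  have hBi : Integrable B μ := (hpw2.const_mul _).add hconst
  have hN0 : 0 < N := hβ0.trans hN
  have hmin : Integrable (fun x => min (w x) N ^ (1 + ε)) μ := by
    refine Integrable.of_bound (C := N ^ (1 + ε))
      ((hw.aemeasurable.min aemeasurable_const).pow_const _).aestronglyMeasurable ?_
    filter_upwards [hpos] with x hx
    have h0 : 0 ≤ min (w x) N := le_min hx.le hN0.le
    rw [Real.norm_of_nonneg (Real.rpow_nonneg h0 _)]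
    exact Real.rpow_le_rpow h0 (min_le_right _ _) (by linarith)
  have hmain : ∫ x, (c * min (w x) N ^ (1 + ε) - B x) ∂μ ≤ 0 := by
    refine le_trans (integral_mono_ae ((hmin.const_mul c).sub hBi) hprod.integral_prod_left ?_)
      hswap
    filter_upwards [hpos] with x hx
    exact le_integral_rpow_mul_posGap (by linarith) hε hgε hx hβ0 hN hc hc0
  rw [integral_sub (hmin.const_mul c) hBi, integral_const_mul] at hmain
  have hBint : ∫ x, B x ∂μ ≤ (b - a) * β ^ (1 + ε) * (g ^ 2 / ε + g / ε ^ 2 + g + c) := by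
    have hwint : ∫ x, w x ∂μ = (b - a) * (g * β) := by
      rw [hgβ]; exact (mul_intervalMean hab).symm
    have e1 : β ^ (1 + ε) = β ^ ε * β := by rw [add_comm, Real.rpow_add_one hβ0.ne']
    have hβε : 0 < β ^ ε := Real.rpow_pos_of_pos hβ0 ε
    simp only [B]
    rw [integral_add (hpw2.const_mul _) hconst, integral_const_mul, integral_add hpw
      (hw.div_const _), integral_div, integral_div, integral_add hpg (hw.const_mul g),
      integral_const_mul, hwint, e1]
    have h1 : ∫ x, posGap g β (w x) ∂μ ≤ 0 := hlev β le_rfl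
    have h2 : ∫ _ : ℝ, (g + c) * (β ^ ε * β) ∂μ = (b - a) * ((g + c) * (β ^ ε * β)) := by
      simp [μ, hab.le]
    rw [h2]
    have h3 : (∫ x, posGap g β (w x) ∂μ) / ε ≤ 0 := div_nonpos_of_nonpos_of_nonneg h1 hε.le
    have h4 := mul_nonpos_of_nonneg_of_nonpos hβε.le h3
    have h5 : β ^ ε * (((∫ x, posGap g β (w x) ∂μ) + g * ((b - a) * (g * β))) / ε +
        (b - a) * (g * β) / ε ^ 2) + (b - a) * ((g + c) * (β ^ ε * β)) =
        β ^ ε * ((∫ x, posGap g β (w x) ∂μ) / ε) +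
        (b - a) * (β ^ ε * β) * (g ^ 2 / ε + g / ε ^ 2 + g + c) := by
      field_simp
      ring
    linarith
  linarith

/-- Sharp self-improvement with explicit upper bound `Q` for the entropies. -/
theorem memRH_of_entropyMean_le {I : Set ℝ} {w : ℝ → ℝ} {Q g ε : ℝ} (hw : IsWeightOn I w)
    (hg : 1 < g) (hgQ : g - Real.log g = Q + 1)
    (hQ : ∀ c d, c < d → Icc c d ⊆ I → entropyMean w c d ≤ Q) (hε : 0 < ε)
    (hεg : ε < 1 / (g - 1)) : MemRH (1 + ε) I w := by
  have hgε : ε * (g - 1) < 1 := by rwa [lt_div_iff₀ (by linarith)] at hεg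
  set c : ℝ := 1 / ε ^ 2 - g / (ε * (1 + ε)) with hc
  -- The only place where the bound ε < 1/(g-1) on the exponent decides the sign of the leading
  -- coefficient.
  have hc0 : 0 < c := by
    have : c = (1 - ε * (g - 1)) / (ε ^ 2 * (1 + ε)) := by
      rw [hc]
      have : 1 + ε ≠ 0 := by linarith
      field_simp
      ring
    rw [this]
    have : 0 < 1 - ε * (g - 1) := by linarith
    positivity
  set D : ℝ := (g ^ 2 / ε + g / ε ^ 2 + g + c) / c
  have hD : 0 < D := by positivity
  refine ⟨hw, lt_of_le_of_lt ?_ (ENNReal.ofReal_lt_top (r := D ^ (1 / (1 + ε)) / g))⟩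
  refine iSup_le fun a => iSup_le fun b => iSup_le fun hab => iSup_le fun hI => ?_
  have hwi := hw.integrableOn_Icc hI
  have hpos := hw.ae_pos_Icc hI
  have hm0 := intervalMean_pos hab hwi hpos
  set m := intervalMean w a b
  have hβ0 : 0 < m / g := by positivity
  have hba : 0 < b - a := by linarith
  have hbound : ∫⁻ x in Icc a b, ENNReal.ofReal (w x ^ (1 + ε)) ≤
      ENNReal.ofReal ((b - a) * (D * (m / g) ^ (1 + ε))) := by
    have hlim : Filter.Tendsto
        (fun n : ℕ => ∫⁻ x in Icc a b, ENNReal.ofReal (min (w x) n ^ (1 + ε))) Filter.atTop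
        (nhds (∫⁻ x in Icc a b, ENNReal.ofReal (w x ^ (1 + ε)))) := by
      refine lintegral_tendsto_of_tendsto_of_monotone (fun n =>
        ((hwi.aemeasurable.min aemeasurable_const).pow_const _).ennreal_ofReal) ?_ ?_
      · filter_upwards [hpos] with x hx n k hnk
        refine ENNReal.ofReal_le_ofReal (Real.rpow_le_rpow (le_min hx.le n.cast_nonneg) ?_
          (by linarith))
        exact min_le_min_left _ (Nat.cast_le.2 hnk)
      · filter_upwards with x
        refine tendsto_const_nhds.congr' ?_
        filter_upwards [Filter.eventually_ge_atTop ⌈w x⌉₊] with n hn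
        rw [min_eq_left (Nat.ceil_le.1 hn)]
    refine le_of_tendsto hlim ?_
    filter_upwards [Filter.eventually_gt_atTop ⌈m / g⌉₊] with n hn
    have hn' : m / g < n := (Nat.le_ceil _).trans_lt (Nat.cast_lt.2 hn)
    have h := integral_min_rpow_le hab hwi hpos hg hgQ (fun p q hp hpq hq =>
      hQ p q hpq ((Icc_subset_Icc hp hq).trans hI)) hε hgε rfl hn' hc hc0
    rw [← ofReal_integral_eq_lintegral_ofReal]
    · refine ENNReal.ofReal_le_ofReal ?_
      rw [← mul_le_mul_iff_right₀ hc0]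
      refine h.trans (le_of_eq ?_)
      simp only [D]
      field_simp
      rfl
    · refine Integrable.of_bound (C := (n : ℝ) ^ (1 + ε))
        ((hwi.aemeasurable.min aemeasurable_const).pow_const _).aestronglyMeasurable ?_
      filter_upwards [hpos] with x hx
      have h0 : 0 ≤ min (w x) n := le_min hx.le n.cast_nonneg
      rw [Real.norm_of_nonneg (Real.rpow_nonneg h0 _)]
      exact Real.rpow_le_rpow h0 (min_le_right _ _) (by linarith)
    · filter_upwards [hpos] with x hx
      exact Real.rpow_nonneg (le_min hx.le n.cast_nonneg) _
  calc ((∫⁻ x in Icc a b, ENNReal.ofReal (w x ^ (1 + ε))) / ENNReal.ofReal (b - a)) ^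
        (1 / (1 + ε)) / ENNReal.ofReal m
      ≤ (ENNReal.ofReal ((b - a) * (D * (m / g) ^ (1 + ε))) / ENNReal.ofReal (b - a)) ^
        (1 / (1 + ε)) / ENNReal.ofReal m := by gcongr
    _ = ENNReal.ofReal (D ^ (1 / (1 + ε)) / g) := by
        rw [← ENNReal.ofReal_div_of_pos hba, mul_div_cancel_left₀ _ hba.ne',
          ENNReal.ofReal_rpow_of_nonneg (by positivity) (by positivity),
          ← ENNReal.ofReal_div_of_pos hm0, Real.mul_rpow hD.le (by positivity),
          ← Real.rpow_mul hβ0.le, mul_one_div_cancel (by linarith), Real.rpow_one]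
        congr 1
        field_simp

/-! ### Profiles and their concatenation. -/

/-- Measurable functions with values in some interval `[1, N]`. -/
def IsBddProfile (f : ℝ → ℝ) : Prop := Measurable f ∧ ∃ N, ∀ x, 1 ≤ f x ∧ f x ≤ N

theorem intervalIntegrable_comp_of_bdd {f φ : ℝ → ℝ} (hf : Measurable f) (hφ : Continuous φ)
    {a b l u : ℝ} (h : ∀ x ∈ uIcc a b, l ≤ f x ∧ f x ≤ u) :
    IntervalIntegrable (fun x => φ (f x)) volume a b := by
  obtain ⟨C, hC⟩ := isCompact_Icc.exists_bound_of_continuousOn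
    (hφ.continuousOn : ContinuousOn φ (Icc l u))
  rw [intervalIntegrable_iff]
  refine Measure.integrableOn_of_bounded (M := C) (by simp)
    (hφ.measurable.comp hf).aestronglyMeasurable ?_
  filter_upwards [ae_restrict_mem measurableSet_uIoc] with x hx
  exact hC _ (h x (uIoc_subset_uIcc hx))

theorem IsBddProfile.intervalIntegrable {f φ : ℝ → ℝ} (hf : IsBddProfile f) (hφ : Continuous φ)
    (a b : ℝ) : IntervalIntegrable (fun x => φ (f x)) volume a b :=
  let ⟨_, hN⟩ := hf.2
  intervalIntegrable_comp_of_bdd hf.1 hφ fun x _ => hN x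

theorem continuous_tangentGap (g : ℝ) {β : ℝ} (hβ : 0 < β) : Continuous (tangentGap g β) := by
  have h : (fun w => β * ((w / β) * Real.log (w / β)) - g * (w - β)) = tangentGap g β := by
    funext w
    unfold tangentGap
    field_simp
  rw [← h]
  exact (continuous_const.mul (Real.continuous_mul_log.comp (continuous_id.div_const β))).sub
    (by fun_prop)

theorem tangentGap_mul (g : ℝ) {θ β w : ℝ} (hθ : 0 < θ) :
    tangentGap g (θ * β) (θ * w) = θ * tangentGap g β w := by
  unfold tangentGap
  rw [mul_div_mul_left _ _ hθ.ne']
  ring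

/-- `f` on `[0, S]` followed by a translate of `k`. -/
noncomputable def concat (f : ℝ → ℝ) (S : ℝ) (k : ℝ → ℝ) (x : ℝ) : ℝ :=
  if x ≤ S then f x else k (x - S)

theorem IsBddProfile.concat {f k : ℝ → ℝ} (hf : IsBddProfile f) (hk : IsBddProfile k) (S : ℝ) :
    IsBddProfile (concat f S k) := by
  obtain ⟨hfm, N, hN⟩ := hf
  obtain ⟨hkm, K, hK⟩ := hk
  refine ⟨hfm.ite measurableSet_Iic (hkm.comp (measurable_id.sub_const S)), max N K, fun x => ?_⟩
  unfold _root_.concat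
  split_ifs
  · exact ⟨(hN x).1, (hN x).2.trans (le_max_left _ _)⟩
  · exact ⟨(hK _).1, (hK _).2.trans (le_max_right _ _)⟩

theorem integral_concat_left {f k φ : ℝ → ℝ} {S a b : ℝ} (hab : a ≤ b) (hb : b ≤ S) :
    ∫ x in a..b, φ (concat f S k x) = ∫ x in a..b, φ (f x) := by
  rw [intervalIntegral.integral_of_le hab, intervalIntegral.integral_of_le hab]
  refine setIntegral_congr_fun measurableSet_Ioc fun x hx => ?_
  simp only [concat, if_pos (hx.2.trans hb)]

theorem integral_concat_right {f k φ : ℝ → ℝ} {S a b : ℝ} (hab : a ≤ b) (ha : S ≤ a) :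
    ∫ x in a..b, φ (concat f S k x) = ∫ x in (a - S)..(b - S), φ (k x) := by
  rw [← intervalIntegral.integral_comp_sub_right (fun x => φ (k x)) S,
    intervalIntegral.integral_of_le hab, intervalIntegral.integral_of_le hab]
  refine setIntegral_congr_fun measurableSet_Ioc fun x hx => ?_
  simp only [concat, if_neg (not_le.2 (ha.trans_lt hx.1))]

theorem integral_concat {f k φ : ℝ → ℝ} {S a b : ℝ} (hf : IsBddProfile f) (hk : IsBddProfile k)
    (hφ : Continuous φ) (ha : a ≤ S) (hb : S ≤ b) :
    ∫ x in a..b, φ (concat f S k x) =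
      (∫ x in a..S, φ (f x)) + ∫ x in (0 : ℝ)..(b - S), φ (k x) := by
  have hi := (hf.concat hk S).intervalIntegrable hφ
  rw [← intervalIntegral.integral_add_adjacent_intervals (hi a S) (hi S b),
    integral_concat_left ha le_rfl, integral_concat_right hb le_rfl, sub_self]

/-- The integrals of `φ ∘ f` over initial segments of `[0, T]` are at most `s`. -/
def InitLe (φ f : ℝ → ℝ) (T s : ℝ) : Prop := ∀ x ∈ Icc 0 T, ∫ t in (0 : ℝ)..x, φ (f t) ≤ s

/-- The integrals of `φ ∘ f` over final segments of `[0, T]` are at most `s`. -/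
def FinalLe (φ f : ℝ → ℝ) (T s : ℝ) : Prop := ∀ x ∈ Icc 0 T, ∫ t in x..T, φ (f t) ≤ s

theorem InitLe.concat {φ f k : ℝ → ℝ} {S T s t : ℝ} (hS : 0 ≤ S) (hf : IsBddProfile f)
    (hk : IsBddProfile k) (hφ : Continuous φ) (h1 : InitLe φ f S s) (h2 : InitLe φ k T t)
    (h3 : (∫ x in (0 : ℝ)..S, φ (f x)) + t ≤ s) : InitLe φ (concat f S k) (S + T) s := by
  intro x hx
  rcases le_total x S with hxS | hxS
  · rw [integral_concat_left hx.1 hxS]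
    exact h1 x ⟨hx.1, hxS⟩
  · rw [integral_concat hf hk hφ hS hxS]
    have := h2 (x - S) ⟨by linarith, by linarith [hx.2]⟩
    linarith

theorem FinalLe.concat {φ f k : ℝ → ℝ} {S T s t : ℝ} (hT : 0 ≤ T) (hf : IsBddProfile f)
    (hk : IsBddProfile k) (hφ : Continuous φ) (h1 : FinalLe φ f S t) (h2 : FinalLe φ k T s)
    (h3 : t + ∫ x in (0 : ℝ)..T, φ (k x) ≤ s) : FinalLe φ (concat f S k) (S + T) s := by
  intro x hx
  rcases le_total x S with hxS | hxS
  · rw [integral_concat hf hk hφ hxS (by linarith), add_sub_cancel_left]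
    have := h1 x ⟨hx.1, hxS⟩
    linarith
  · rw [integral_concat_right hx.2 hxS, add_sub_cancel_left]
    exact h2 (x - S) ⟨by linarith, by linarith [hx.2]⟩

/-- A profile on `[0, T]` over the base value `1`: every subinterval satisfies the tangent
condition, and initial and final segments satisfy it with the tangent through the base value. -/
structure IsProfile (g : ℝ) (f : ℝ → ℝ) (T : ℝ) : Prop where
  pos : 0 < T
  bdd : IsBddProfile f
  init : InitLe (tangentGap g 1) f T 0
  final : FinalLe (tangentGap g 1) f T 0
  inner : ∀ a b, 0 ≤ a → a < b → b ≤ T → ∃ β, 0 < β ∧ ∫ x in a..b, tangentGap g β (f x) ≤ 0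

/-- An interval across the junction is a final segment of one piece followed by an initial segment
of the other, and both are certified by the same β = 1. -/
theorem IsProfile.concat {g S T : ℝ} {f k : ℝ → ℝ} (hf : IsProfile g f S)
    (hk : IsProfile g k T) : IsProfile g (concat f S k) (S + T) where
  pos := add_pos hf.pos hk.pos
  bdd := hf.bdd.concat hk.bdd S
  init := hf.init.concat hf.pos.le hf.bdd hk.bdd (continuous_tangentGap g one_pos) hk.init
    (by rw [add_zero]; exact hf.init S ⟨hf.pos.le, le_rfl⟩)
  final := hf.final.concat hk.pos.le hf.bdd hk.bdd (continuous_tangentGap g one_pos) hk.final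
    (by rw [zero_add]; exact hk.init T ⟨hk.pos.le, le_rfl⟩)
  inner a b ha hab hb := by
    rcases le_total b S with hbS | hbS
    · obtain ⟨β, hβ, h⟩ := hf.inner a b ha hab hbS
      exact ⟨β, hβ, by rwa [integral_concat_left hab.le hbS]⟩
    rcases le_total S a with hSa | hSa
    · obtain ⟨β, hβ, h⟩ := hk.inner (a - S) (b - S) (by linarith) (by linarith) (by linarith)
      exact ⟨β, hβ, by rwa [integral_concat_right hab.le hSa]⟩
    · refine ⟨1, one_pos, ?_⟩
      rw [integral_concat hf.bdd hk.bdd (continuous_tangentGap g one_pos) hSa hbS]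
      exact add_nonpos (hf.final a ⟨ha, hSa⟩) (hk.init (b - S) ⟨by linarith, by linarith⟩)

theorem tangentGap_one_one (g : ℝ) : tangentGap g 1 1 = 0 := by simp [tangentGap]

theorem isBddProfile_one : IsBddProfile fun _ => 1 := ⟨measurable_const, 1, fun _ => by simp⟩

theorem isProfile_one {g d : ℝ} (hd : 0 < d) : IsProfile g (fun _ => 1) d where
  pos := hd
  bdd := isBddProfile_one
  init x hx := by simp [tangentGap_one_one]
  final x hx := by simp [tangentGap_one_one]
  inner a b _ _ _ := ⟨1, one_pos, by simp [tangentGap_one_one]⟩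

theorem IsBddProfile.const_mul {f : ℝ → ℝ} (hf : IsBddProfile f) {θ : ℝ} (hθ : 1 ≤ θ) :
    IsBddProfile fun x => θ * f x := by
  obtain ⟨hfm, N, hN⟩ := hf
  refine ⟨hfm.const_mul θ, θ * N, fun x => ⟨?_, ?_⟩⟩
  · nlinarith [(hN x).1]
  · exact mul_le_mul_of_nonneg_left (hN x).2 (by linarith)

/-! ### Blocks with large critical moment. -/

/-- A profile with control of the means over initial and final segments. -/
structure IsBlock (g h : ℝ) (f : ℝ → ℝ) (T : ℝ) : Prop extends IsProfile g f T where
  meanInit : InitLe (fun u => u - h) f T 0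
  meanFinal : FinalLe (fun u => u - h) f T 0

/-- Comes from log (θ f) = log θ + log f. Rescaling adds a multiple of the excess of f over h and a
constant, nonpositive under the relation between θ, h and g in `IsBlock.const_mul`. -/
theorem IsBddProfile.integral_gap_const_mul {g h θ : ℝ} {f : ℝ → ℝ} (hf : IsBddProfile f)
    (hθ : 1 ≤ θ) (a b : ℝ) :
    ∫ x in a..b, tangentGap g 1 (θ * f x) = θ * (∫ x in a..b, tangentGap g 1 (f x)) +
      (θ * Real.log θ * (∫ x in a..b, (f x - h)) +
        (b - a) * (θ * Real.log θ * h - g * (θ - 1))) := by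
  have h1 := hf.intervalIntegrable (continuous_tangentGap g one_pos) a b
  have h2 := hf.intervalIntegrable (by fun_prop : Continuous fun u : ℝ => u - h) a b
  obtain ⟨N, hN⟩ := hf.2
  rw [← intervalIntegral.integral_const_mul, ← intervalIntegral.integral_const_mul,
    ← smul_eq_mul (b - a), ← intervalIntegral.integral_const,
    ← intervalIntegral.integral_add (h2.const_mul _) (by simp),
    ← intervalIntegral.integral_add (h1.const_mul _) ((h2.const_mul _).add (by simp))]
  refine intervalIntegral.integral_congr fun x _ => ?_
  have hx : 0 < f x := by linarith [(hN x).1]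
  simp only [tangentGap, div_one]
  rw [Real.log_mul (by linarith) hx.ne']
  ring

/-- Rescaling the values of a block preserves the profile conditions over the old base value. -/
theorem IsBlock.const_mul {g h θ T : ℝ} {f : ℝ → ℝ} (hf : IsBlock g h f T) (hθ : 1 ≤ θ)
    (hgh : θ * Real.log θ * h ≤ g * (θ - 1)) : IsProfile g (fun x => θ * f x) T where
  pos := hf.pos
  bdd := hf.bdd.const_mul hθ
  init x hx := by
    rw [hf.bdd.integral_gap_const_mul (h := h) hθ]
    have h0 : 0 ≤ θ * Real.log θ := mul_nonneg (by linarith) (Real.log_nonneg hθ)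
    refine add_nonpos (mul_nonpos_of_nonneg_of_nonpos (by linarith) (hf.init x hx))
      (add_nonpos (mul_nonpos_of_nonneg_of_nonpos h0 (hf.meanInit x hx))
        (mul_nonpos_of_nonneg_of_nonpos (by linarith [hx.1]) (by linarith)))
  final x hx := by
    rw [hf.bdd.integral_gap_const_mul (h := h) hθ]
    have h0 : 0 ≤ θ * Real.log θ := mul_nonneg (by linarith) (Real.log_nonneg hθ)
    refine add_nonpos (mul_nonpos_of_nonneg_of_nonpos (by linarith) (hf.final x hx))
      (add_nonpos (mul_nonpos_of_nonneg_of_nonpos h0 (hf.meanFinal x hx))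
        (mul_nonpos_of_nonneg_of_nonpos (by linarith [hx.2]) (by linarith)))
  inner a b ha hab hb := by
    obtain ⟨β, hβ, hle⟩ := hf.inner a b ha hab hb
    have hθ0 : 0 < θ := by linarith
    refine ⟨θ * β, mul_pos hθ0 hβ, ?_⟩
    simp only [tangentGap_mul g hθ0]
    rw [intervalIntegral.integral_const_mul]
    exact mul_nonpos_of_nonneg_of_nonpos hθ0.le hle

theorem integral_mean_const_mul {h θ : ℝ} {f : ℝ → ℝ} (hf : IsBddProfile f) (a b : ℝ) :
    ∫ x in a..b, (θ * f x - h) = θ * (∫ x in a..b, (f x - h)) + (b - a) * ((θ - 1) * h) := by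
  have h2 := hf.intervalIntegrable (by fun_prop : Continuous fun u : ℝ => u - h) a b
  rw [← intervalIntegral.integral_const_mul, ← smul_eq_mul (b - a),
    ← intervalIntegral.integral_const, ← intervalIntegral.integral_add (h2.const_mul _) (by simp)]
  refine intervalIntegral.integral_congr fun x _ => ?_
  ring

/-- `M` rescaled copies of a block, separated and surrounded by intervals of length `d` on which
the base value is taken, form a block. -/
theorem IsBlock.exists_copies {g h θ T d r : ℝ} {f : ℝ → ℝ} (hf : IsBlock g h f T) (hθ : 1 ≤ θ)
    (hgh : θ * Real.log θ * h ≤ g * (θ - 1)) (hh : 1 ≤ h) (hd : 0 < d) (hr : 0 ≤ r)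
    (hdT : T * ((θ - 1) * h) = d * (h - 1)) (M : ℕ) :
    ∃ k : ℝ → ℝ, IsBlock g h k ((M + 1) * d + M * T) ∧
      ∫ x in (0 : ℝ)..((M + 1) * d + M * T), (k x - h) ≤ -(d * (h - 1)) ∧
      ∫ x in (0 : ℝ)..((M + 1) * d + M * T), k x ^ r =
        (M + 1) * d + M * (θ ^ r * ∫ x in (0 : ℝ)..T, f x ^ r) := by
  have hφ : Continuous fun u : ℝ => u - h := by fun_prop
  have hrc : Continuous fun u : ℝ => u ^ r := Real.continuous_rpow_const hr
  have hdead : ∀ a b : ℝ, ∫ _ in a..b, ((1 : ℝ) - h) = -((b - a) * (h - 1)) := fun a b => by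
    simp; ring
  have hdI : InitLe (fun u => u - h) (fun _ => 1) d 0 := fun x hx => by
    simp only [hdead]; nlinarith [hx.1]
  have hdF : FinalLe (fun u => u - h) (fun _ => 1) d 0 := fun x hx => by
    simp only [hdead]; nlinarith [hx.2]
  have hθP := hf.const_mul hθ hgh
  -- A rescaled copy exceeds the mean h by a total of at most T(θ-1)h, which `hdT` matches with the
  -- deficit d(h-1) of one stretch of value 1.
  have hθI : InitLe (fun u => u - h) (fun x => θ * f x) T (d * (h - 1)) := fun x hx => by
    rw [integral_mean_const_mul hf.bdd, ← hdT]
    have h1 := mul_nonpos_of_nonneg_of_nonpos (by linarith : (0 : ℝ) ≤ θ) (hf.meanInit x hx)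
    have h2 : (x - 0) * ((θ - 1) * h) ≤ T * ((θ - 1) * h) :=
      mul_le_mul_of_nonneg_right (by linarith [hx.2]) (mul_nonneg (by linarith) (by linarith))
    linarith
  have hθF : FinalLe (fun u => u - h) (fun x => θ * f x) T (d * (h - 1)) := fun x hx => by
    rw [integral_mean_const_mul hf.bdd, ← hdT]
    have h1 := mul_nonpos_of_nonneg_of_nonpos (by linarith : (0 : ℝ) ≤ θ) (hf.meanFinal x hx)
    have h2 : (T - x) * ((θ - 1) * h) ≤ T * ((θ - 1) * h) :=
      mul_le_mul_of_nonneg_right (by linarith [hx.1]) (mul_nonneg (by linarith) (by linarith))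
    linarith
  have hθtot := hθI T ⟨hf.pos.le, le_rfl⟩
  have hθr : ∫ x in (0 : ℝ)..T, (θ * f x) ^ r = θ ^ r * ∫ x in (0 : ℝ)..T, f x ^ r := by
    rw [← intervalIntegral.integral_const_mul]
    refine intervalIntegral.integral_congr fun x _ => ?_
    obtain ⟨N, hN⟩ := hf.bdd.2
    exact Real.mul_rpow (by linarith) (by linarith [(hN x).1])
  induction M with
  | zero =>
    refine ⟨fun _ => 1, ?_, ?_, ?_⟩
    · simp only [Nat.cast_zero, zero_add, one_mul, zero_mul, add_zero]
      exact ⟨isProfile_one hd, hdI, hdF⟩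
    · rw [hdead]; simp
    · simp
  | succ M ih =>
    obtain ⟨k, hk, hkm, hkr⟩ := ih
    set L := (M + 1) * d + M * T
    have hL : ((M + 1 : ℕ) + 1) * d + (M + 1 : ℕ) * T = d + (T + L) := by
      push_cast
      simp only [L]
      ring
    rw [hL]
    set k₁ := concat (fun x => θ * f x) T k
    have hk₁ : IsProfile g k₁ (T + L) := hθP.concat hk.toIsProfile
    have hk₁tot : ∫ x in (0 : ℝ)..(T + L), (k₁ x - h) =
        (∫ x in (0 : ℝ)..T, (θ * f x - h)) + ∫ x in (0 : ℝ)..L, (k x - h) := by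
      have := integral_concat hθP.bdd hk.bdd hφ hf.pos.le (by linarith [hk.pos] : T ≤ T + L)
      rwa [add_sub_cancel_left] at this
    have htot : ∫ x in (0 : ℝ)..(d + (T + L)), (concat (fun _ => 1) d k₁ x - h) =
        -(d * (h - 1)) + ∫ x in (0 : ℝ)..(T + L), (k₁ x - h) := by
      have := integral_concat isBddProfile_one hk₁.bdd hφ hd.le
        (by linarith [hk₁.pos] : d ≤ d + (T + L))
      rwa [add_sub_cancel_left, hdead, sub_zero] at this
    have hI₁ : InitLe (fun u => u - h) k₁ (T + L) (d * (h - 1)) :=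
      hθI.concat hf.pos.le hθP.bdd hk.bdd hφ hk.meanInit (by linarith)
    have hF₁ : FinalLe (fun u => u - h) k₁ (T + L) 0 :=
      hθF.concat hk.pos.le hθP.bdd hk.bdd hφ hk.meanFinal (by linarith)
    refine ⟨concat (fun _ => 1) d k₁, ⟨(isProfile_one hd).concat hk₁, ?_, ?_⟩, ?_, ?_⟩
    · refine hdI.concat hd.le isBddProfile_one hk₁.bdd hφ hI₁ ?_
      rw [hdead]
      linarith
    · refine hdF.concat hk₁.pos.le isBddProfile_one hk₁.bdd hφ hF₁ ?_
      linarith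
    · linarith
    · have h1 := integral_concat isBddProfile_one hk₁.bdd hrc hd.le
        (by linarith [hk₁.pos] : d ≤ d + (T + L))
      have h2 := integral_concat hθP.bdd hk.bdd hrc hf.pos.le (by linarith [hk.pos] : T ≤ T + L)
      rw [add_sub_cancel_left] at h1 h2
      rw [h1, h2, hkr, hθr]
      simp
      ring

/-- Blocks with arbitrarily large `r`-th moment at the critical exponent `r = g / (g - 1)`. -/
theorem exists_block_moment {g : ℝ} (hg : 1 < g) {A : ℝ} (hA : 1 ≤ A) :
    ∃ h T : ℝ, ∃ f : ℝ → ℝ, h ≤ g ∧ IsBlock g h f T ∧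
      A * T ≤ ∫ x in (0 : ℝ)..T, f x ^ (g / (g - 1)) := by
  set r := g / (g - 1) with hr
  have hg1 : 0 < g - 1 := by linarith
  have hr1 : 1 < r := by rw [hr, one_lt_div hg1]; linarith
  have hgr : g = r / (r - 1) := by
    have : r - 1 = 1 / (g - 1) := by rw [hr]; field_simp; ring
    rw [this, hr]; field_simp
  have hA0 : 0 < A := by linarith
  -- The numbers g and r are conjugate exponents, as are h and x. Taking x slightly above r puts h
  -- slightly below g; the margin t is tuned to the target A.
  set t := 1 / (2 * A) with ht
  have ht0 : 0 < t := by positivity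
  set x := r * (1 + t) with hx
  have hxr : r < x := by rw [hx]; nlinarith
  set h := x / (x - 1) with hh
  have hx1 : 0 < x - 1 := by linarith
  have hh1 : 1 < h := by rw [hh, one_lt_div hx1]; linarith
  have hhg : h < g := by
    rw [hgr, hh, div_lt_div_iff₀ hx1 (by linarith)]
    nlinarith
  have hhx : x * (h - 1) = h := by rw [hh]; field_simp; ring
  set θ := g / h with hθ
  have hθ1 : 1 < θ := by rw [hθ, one_lt_div (by linarith)]; exact hhg
  have hθh : θ * h = g := by rw [hθ]; field_simp
  have hlog : θ * Real.log θ * h ≤ g * (θ - 1) := by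
    rw [mul_right_comm, hθh]
    exact mul_le_mul_of_nonneg_left (Real.log_le_sub_one_of_pos (by linarith)) (by linarith)
  obtain ⟨M, hM⟩ := exists_nat_ge (2 * A)
  have hM0 : (0 : ℝ) < M := by linarith
  have hMt : 1 ≤ M * t := by
    rw [ht, mul_one_div, one_le_div (by linarith)]
    exact hM
  set δ := (θ - 1) * x
  have hδ : 0 < δ := mul_pos (by linarith) (by linarith)
  have hbern : r * (θ - 1) ≤ θ ^ r - 1 := by
    have := one_add_mul_self_le_rpow_one_add (by linarith : -1 ≤ θ - 1) hr1.le
    rw [add_sub_cancel] at this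
    linarith
  -- Two losses, each at most Mδ/2: the extra stretch of value 1, by Mt ≥ 1, and the gap between x
  -- and r, by 2At = 1 and Bernoulli's inequality for θ^r.
  have hkey : A * ((M + 1) * δ - M * (θ ^ r - 1)) ≤ M * δ := by
    have hAt : 2 * A * t = 1 := by rw [ht]; field_simp
    have h1 : A * (M * (r * (θ - 1))) ≤ A * (M * (θ ^ r - 1)) := by gcongr
    have h2 : A * δ ≤ A * δ * (M * t) := le_mul_of_one_le_right (by positivity) hMt
    have h3 : r * (θ - 1) = δ - (θ - 1) * r * t := by simp only [δ, hx]; ring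
    have h4 : (θ - 1) * r ≤ δ := mul_le_mul_of_nonneg_left hxr.le (by linarith)
    have h5 : A * M * t * ((θ - 1) * r) ≤ A * M * t * δ := by gcongr
    rw [h3] at h1
    have h6 : 2 * A * t * (M * δ) = M * δ := by rw [hAt, one_mul]
    nlinarith
  set c := δ / (M + (M + 1) * δ)
  have hc : 0 < c := by positivity
  -- While the average moment V / T is below A, each iteration raises it by at least c, which does
  -- not depend on n.
  have hstep : ∀ n : ℕ, ∃ T : ℝ, ∃ f : ℝ → ℝ, IsBlock g h f T ∧
      (A * T ≤ (∫ x in (0 : ℝ)..T, f x ^ r) ∨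
        (1 + c * n) * T ≤ ∫ x in (0 : ℝ)..T, f x ^ r) := by
    intro n
    induction n with
    | zero =>
      refine ⟨1, fun _ => 1, ⟨isProfile_one one_pos, fun y hy => ?_, fun y hy => ?_⟩, Or.inr ?_⟩
      · simp only [intervalIntegral.integral_const, smul_eq_mul]
        nlinarith [hy.1]
      · simp only [intervalIntegral.integral_const, smul_eq_mul]
        nlinarith [hy.2]
      · simp
    | succ n ih =>
      obtain ⟨T, f, hf, hV⟩ := ih
      by_cases hAT : A * T ≤ ∫ x in (0 : ℝ)..T, f x ^ r
      · exact ⟨T, f, hf, Or.inl hAT⟩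
      have hV := hV.resolve_left hAT
      set V := ∫ x in (0 : ℝ)..T, f x ^ r
      have hT := hf.pos
      obtain ⟨k, hk, -, hkr⟩ := hf.exists_copies (d := T * δ) hθ1.le hlog hh1.le
        (by positivity) (by linarith : 0 ≤ r)
        (by simp only [δ]; linear_combination (-T * (θ - 1)) * hhx) M
      refine ⟨_, k, hk, Or.inr ?_⟩
      rw [hkr]
      have hV0 : 0 ≤ V := le_trans (by positivity) hV
      have h1 : V * ((M + 1) * δ - M * (θ ^ r - 1)) ≤ T * (M * δ) := by
        rcases le_total ((M + 1) * δ - M * (θ ^ r - 1)) 0 with hneg | hpos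
        · exact (mul_nonpos_of_nonneg_of_nonpos hV0 hneg).trans (by positivity)
        · calc V * ((M + 1) * δ - M * (θ ^ r - 1)) ≤ A * T * ((M + 1) * δ - M * (θ ^ r - 1)) :=
                mul_le_mul_of_nonneg_right (not_le.1 hAT).le hpos
            _ = T * (A * ((M + 1) * δ - M * (θ ^ r - 1))) := by ring
            _ ≤ T * (M * δ) := mul_le_mul_of_nonneg_left hkey hT.le
      have h2 : c * (M + (M + 1) * δ) = δ := by simp only [c]; field_simp
      have h3 : (1 + c * n) * T * (M + (M + 1) * δ) ≤ V * (M + (M + 1) * δ) :=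
        mul_le_mul_of_nonneg_right hV (by positivity)
      push_cast
      have h4 : (1 + c * (n + 1)) * ((M + 1) * (T * δ) + M * T) =
          (1 + c * n) * T * (M + (M + 1) * δ) + T * δ := by
        linear_combination T * h2
      rw [h4]
      linarith
  obtain ⟨n, hn⟩ := exists_nat_ge (A / c)
  obtain ⟨T, f, hf, hV⟩ := hstep n
  refine ⟨h, T, f, hhg.le, hf, ?_⟩
  rcases hV with hV | hV
  · exact hV
  · refine le_trans (mul_le_mul_of_nonneg_right ?_ hf.pos.le) hV
    rw [div_le_iff₀ hc] at hn
    linarith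

/-- A block of length one with large critical moment. -/
theorem exists_unit_block {g : ℝ} (hg : 1 < g) (n : ℕ) :
    ∃ f : ℝ → ℝ, IsProfile g f 1 ∧ ∫ x in (0 : ℝ)..1, f x ≤ g ∧
      (n : ℝ) ≤ ∫ x in (0 : ℝ)..1, f x ^ (g / (g - 1)) := by
  obtain ⟨h, T, f, hh, hf, hV⟩ := exists_block_moment hg
    (by linarith [n.cast_nonneg (α := ℝ)] : (1 : ℝ) ≤ n + 1)
  have hT := hf.pos
  have hscale : ∀ (φ : ℝ → ℝ) (a b : ℝ),
      ∫ x in a..b, φ (f (T * x)) = T⁻¹ * ∫ x in (T * a)..(T * b), φ (f x) := fun φ a b => by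
    rw [intervalIntegral.integral_comp_mul_left (fun x => φ (f x)) hT.ne', smul_eq_mul]
  have hmem : ∀ x ∈ Icc (0 : ℝ) 1, T * x ∈ Icc 0 T := fun x hx =>
    ⟨mul_nonneg hT.le hx.1, mul_le_of_le_one_right hT.le hx.2⟩
  have hTi : 0 ≤ T⁻¹ := (inv_pos.2 hT).le
  obtain ⟨hfm, N, hN⟩ := hf.bdd
  refine ⟨fun x => f (T * x), ⟨one_pos, ⟨hfm.comp (measurable_const_mul T), N, fun x => hN _⟩,
    fun x hx => ?_, fun x hx => ?_, fun a b ha hab hb => ?_⟩, ?_, ?_⟩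
  · rw [hscale, mul_zero]
    exact mul_nonpos_of_nonneg_of_nonpos hTi (hf.init _ (hmem x hx))
  · rw [hscale, mul_one]
    exact mul_nonpos_of_nonneg_of_nonpos hTi (hf.final _ (hmem x hx))
  · obtain ⟨β, hβ, hle⟩ := hf.inner (T * a) (T * b) (mul_nonneg hT.le ha)
      (mul_lt_mul_of_pos_left hab hT) (mul_le_of_le_one_right hT.le hb)
    refine ⟨β, hβ, ?_⟩
    rw [hscale]
    exact mul_nonpos_of_nonneg_of_nonpos hTi hle
  · have h1 := hscale (fun u => u) 0 1
    have h2 : ∫ x in (0 : ℝ)..T, (f x - h) ≤ 0 := hf.meanInit T ⟨hT.le, le_rfl⟩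
    have h3 : IntervalIntegrable f volume 0 T := hf.bdd.intervalIntegrable continuous_id 0 T
    rw [intervalIntegral.integral_sub h3 (by simp)] at h2
    simp only [intervalIntegral.integral_const, sub_zero, smul_eq_mul] at h2
    simp only [mul_zero, mul_one] at h1
    rw [h1, inv_mul_le_iff₀ hT]
    nlinarith
  · have h1 := hscale (fun u => u ^ (g / (g - 1))) 0 1
    simp only [mul_zero, mul_one] at h1
    rw [h1, le_inv_mul_iff₀ hT]
    nlinarith

/-! ### Gluing unit blocks into a weight on the line. -/

/-- The function equal to `F n` (translated) on each `(n - 1, n]`, and to `F 0` on `(-∞, 0]`. -/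
noncomputable def glue (F : ℕ → ℝ → ℝ) (x : ℝ) : ℝ := F ⌈x⌉₊ (x - ⌈x⌉₊ + 1)

section glue

variable {F : ℕ → ℝ → ℝ}

theorem measurable_glue (hF : ∀ n, Measurable (F n)) : Measurable (glue F) := by
  have h1 : Measurable fun z : ℝ × ℕ => F z.2 z.1 := measurable_from_prod_countable_left hF
  have h2 : Measurable fun x : ℝ => (x - (⌈x⌉₊ : ℝ) + 1, ⌈x⌉₊) :=
    (Measurable.add_const (measurable_id.sub
      ((measurable_from_nat (f := fun n : ℕ => (n : ℝ))).comp Nat.measurable_ceil)) 1).prodMk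
      Nat.measurable_ceil
  exact h1.comp h2

theorem glue_eq {n : ℕ} {x : ℝ} (h1 : (n : ℝ) < x) (h2 : x ≤ n + 1) :
    glue F x = F (n + 1) (x - n) := by
  have : ⌈x⌉₊ = n + 1 := by
    rw [Nat.ceil_eq_iff (by simp)]
    simpa using ⟨h1, h2⟩
  rw [glue, this]
  push_cast
  ring_nf

theorem glue_eq_of_nonpos {x : ℝ} (h : x ≤ 0) : glue F x = F 0 (x + 1) := by
  rw [glue, Nat.ceil_eq_zero.2 h]
  simp

theorem exists_glue_bound (hF : ∀ n, IsBddProfile (F n)) (b : ℝ) :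
    ∃ N, ∀ x ≤ b, 1 ≤ glue F x ∧ glue F x ≤ N := by
  choose N hN using fun n => (hF n).2
  have hN1 : ∀ n, 1 ≤ N n := fun n => (hN n 0).1.trans (hN n 0).2
  refine ⟨∑ n ∈ Finset.range (⌈b⌉₊ + 1), N n, fun x hx => ⟨(hN _ _).1, (hN _ _).2.trans ?_⟩⟩
  exact Finset.single_le_sum (f := N) (fun n _ => by linarith [hN1 n])
    (Finset.mem_range.2 (Nat.lt_succ_of_le (Nat.ceil_le_ceil hx)))

theorem intervalIntegrable_glue (hF : ∀ n, IsBddProfile (F n)) {φ : ℝ → ℝ} (hφ : Continuous φ)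
    (a b : ℝ) : IntervalIntegrable (fun x => φ (glue F x)) volume a b := by
  obtain ⟨N, hN⟩ := exists_glue_bound hF (max a b)
  exact intervalIntegrable_comp_of_bdd (measurable_glue fun n => (hF n).1) hφ
    fun x hx => hN x hx.2

theorem integral_glue {φ : ℝ → ℝ} {n : ℕ} {a b : ℝ} (ha : (n : ℝ) ≤ a) (hab : a ≤ b)
    (hb : b ≤ n + 1) :
    ∫ x in a..b, φ (glue F x) = ∫ x in (a - n)..(b - n), φ (F (n + 1) x) := by
  rw [← intervalIntegral.integral_comp_sub_right (fun x => φ (F (n + 1) x)) (n : ℝ),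
    intervalIntegral.integral_of_le hab, intervalIntegral.integral_of_le hab]
  refine setIntegral_congr_fun measurableSet_Ioc fun x hx => ?_
  rw [glue_eq (ha.trans_lt hx.1) (hx.2.trans hb)]

theorem integral_glue_of_nonpos {φ : ℝ → ℝ} {c : ℝ} (hF0 : ∀ x, F 0 x = c) {a b : ℝ}
    (hab : a ≤ b) (hb : b ≤ 0) : ∫ x in a..b, φ (glue F x) = (b - a) * φ c := by
  have : ∫ x in a..b, φ (glue F x) = ∫ _ in a..b, φ c := by
    rw [intervalIntegral.integral_of_le hab, intervalIntegral.integral_of_le hab]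
    refine setIntegral_congr_fun measurableSet_Ioc fun x hx => ?_
    rw [glue_eq_of_nonpos (hx.2.trans hb), hF0]
  rw [this, intervalIntegral.integral_const, smul_eq_mul]

/-- Glued profiles satisfy the tangent condition on every interval. -/
theorem exists_tangentGap_glue {g : ℝ} (hF : ∀ n, IsProfile g (F n) 1) (hF0 : ∀ x, F 0 x = 1)
    {a b : ℝ} (hab : a < b) :
    ∃ β, 0 < β ∧ ∫ x in a..b, tangentGap g β (glue F x) ≤ 0 := by
  have hbdd := fun n => (hF n).bdd
  have hi := intervalIntegrable_glue hbdd (continuous_tangentGap g one_pos)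
  have hinit : ∀ (n : ℕ) (x : ℝ), (n : ℝ) ≤ x → x ≤ n + 1 →
      ∫ t in (n : ℝ)..x, tangentGap g 1 (glue F t) ≤ 0 := fun n x h1 h2 => by
    rw [integral_glue le_rfl h1 h2, sub_self]
    exact (hF _).init _ ⟨by linarith, by linarith⟩
  have hfinal : ∀ (n : ℕ) (x : ℝ), (n : ℝ) ≤ x → x ≤ n + 1 →
      ∫ t in x..(n + 1 : ℝ), tangentGap g 1 (glue F t) ≤ 0 := fun n x h1 h2 => by
    rw [integral_glue h1 h2 le_rfl, add_sub_cancel_left]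
    exact (hF _).final _ ⟨by linarith, by linarith⟩
  -- An interval meeting several cells splits into a final segment, full cells and an initial
  -- segment, all certified by β = 1.
  have hnat : ∀ n k : ℕ, ∫ t in (n : ℝ)..((n + k : ℕ) : ℝ), tangentGap g 1 (glue F t) ≤ 0 := by
    intro n k
    induction k with
    | zero => simp
    | succ k ih =>
      rw [← intervalIntegral.integral_add_adjacent_intervals (hi _ ((n + k : ℕ) : ℝ)) (hi _ _)]
      refine add_nonpos ih ?_
      have := hinit (n + k) (n + k + 1 : ℕ) (by push_cast; linarith) (by push_cast; linarith)
      exact this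
  have hfrom : ∀ (n : ℕ) (x : ℝ), (n : ℝ) ≤ x →
      ∫ t in (n : ℝ)..x, tangentGap g 1 (glue F t) ≤ 0 := by
    intro n x hx
    have h0 : 0 ≤ x := n.cast_nonneg.trans hx
    have h1 : n ≤ ⌊x⌋₊ := Nat.le_floor hx
    obtain ⟨k, hk⟩ := Nat.exists_eq_add_of_le h1
    rw [← intervalIntegral.integral_add_adjacent_intervals (hi _ (⌊x⌋₊ : ℝ)) (hi _ _)]
    refine add_nonpos ?_ (hinit _ _ (Nat.floor_le h0) (Nat.lt_floor_add_one x).le)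
    rw [hk]
    exact hnat n k
  rcases le_total b 0 with hb0 | hb0
  · refine ⟨1, one_pos, ?_⟩
    rw [integral_glue_of_nonpos hF0 hab.le hb0, tangentGap_one_one, mul_zero]
  rcases le_total a 0 with ha0 | ha0
  · refine ⟨1, one_pos, ?_⟩
    rw [← intervalIntegral.integral_add_adjacent_intervals (hi a 0) (hi 0 b),
      integral_glue_of_nonpos hF0 ha0 le_rfl, tangentGap_one_one, mul_zero, zero_add]
    simpa using hfrom 0 b (by simpa using hb0)
  have hfl := Nat.floor_le ha0
  have hfl' := (Nat.lt_floor_add_one a).le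
  rcases le_total b (⌊a⌋₊ + 1) with hb1 | hb1
  · obtain ⟨β, hβ, h⟩ := (hF (⌊a⌋₊ + 1)).inner (a - ⌊a⌋₊) (b - ⌊a⌋₊) (by linarith) (by linarith)
      (by linarith)
    exact ⟨β, hβ, by rwa [integral_glue hfl hab.le hb1]⟩
  · refine ⟨1, one_pos, ?_⟩
    rw [← intervalIntegral.integral_add_adjacent_intervals (hi a (⌊a⌋₊ + 1)) (hi _ b)]
    refine add_nonpos (hfinal _ _ hfl hfl') ?_
    have := hfrom (⌊a⌋₊ + 1) b (by push_cast; exact hb1)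
    push_cast at this
    exact this

end glue

/-- A weight on the line with critical integrability failing at the sharp exponent. -/
theorem exists_line_weight {C g : ℝ} (hg : 1 < g) (hgC : g - Real.log g = C + 1) :
    ∃ w : ℝ → ℝ, IsWeightOn univ w ∧ RHOneConst univ w ≤ C ∧ ¬ MemRH (g / (g - 1)) univ w := by
  choose B hB hBm hBr using exists_unit_block hg
  set F : ℕ → ℝ → ℝ := fun n => if n = 0 then fun _ => 1 else B n
  have hF : ∀ n, IsProfile g (F n) 1 := fun n => by
    simp only [F]
    split_ifs
    exacts [isProfile_one one_pos, hB n]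
  have hF0 : ∀ x, F 0 x = 1 := fun x => by simp [F]
  have hbdd := fun n => (hF n).bdd
  have hpos : ∀ x, 0 < glue F x := fun x => by
    obtain ⟨N, hN⟩ := exists_glue_bound hbdd x
    linarith [(hN x le_rfl).1]
  have hIcc : ∀ {φ : ℝ → ℝ}, Continuous φ → ∀ {a b : ℝ}, a ≤ b →
      IntegrableOn (fun x => φ (glue F x)) (Icc a b) := fun hφ a b hab =>
    (intervalIntegrable_iff_integrableOn_Icc_of_le hab).1 (intervalIntegrable_glue hbdd hφ a b)
  have hw : IsWeightOn univ (glue F) := by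
    refine ⟨?_, ae_of_all _ hpos⟩
    rw [locallyIntegrableOn_univ]
    intro x
    exact ⟨Icc (x - 1) (x + 1), Icc_mem_nhds (by linarith) (by linarith),
      hIcc continuous_id (by linarith)⟩
  refine ⟨glue F, hw, ?_, ?_⟩
  · refine iSup_le fun a => iSup_le fun b => iSup_le fun hab => iSup_le fun hI => ?_
    obtain ⟨β, hβ, h⟩ := exists_tangentGap_glue hF hF0 hab
    refine entropyMean_le_of_integral_tangentGap hab (hw.integrableOn_Icc hI) (hw.ae_pos_Icc hI)
      (hIcc Real.continuous_mul_log hab.le) hg hgC hβ ?_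
    rwa [setIntegral_Icc_eq_intervalIntegral hab.le]
  · rintro ⟨-, hlt⟩
    set r := g / (g - 1)
    have hr : 0 < r := div_pos (by linarith) (by linarith)
    obtain ⟨K, hK⟩ : ∃ K : ℝ, RHConst r univ (glue F) = ENNReal.ofReal K :=
      ⟨_, (ENNReal.ofReal_toReal hlt.ne).symm⟩
    -- The weight is locally bounded; the failure comes from far cells, where the mean stays at most
    -- g while the r-th moment grows.
    have hn : ∀ n : ℕ, ((n + 1 : ℕ) : ℝ) ^ (1 / r) / g ≤ max K 0 := by
      intro n
      have hab : (n : ℝ) < n + 1 := by linarith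
      have hle : ((∫⁻ x in Icc (n : ℝ) (n + 1), ENNReal.ofReal (glue F x ^ r)) /
          ENNReal.ofReal (n + 1 - n)) ^ (1 / r) /
          ENNReal.ofReal (intervalMean (glue F) n (n + 1)) ≤ RHConst r univ (glue F) :=
        le_iSup_of_le (n : ℝ) (le_iSup_of_le (n + 1 : ℝ)
          (le_iSup_of_le hab (le_iSup_of_le (subset_univ _) le_rfl)))
      have hFn : F (n + 1) = B (n + 1) := by simp [F]
      have hmean : intervalMean (glue F) n (n + 1) ≤ g := by
        have h1 := integral_glue (F := F) (φ := fun u => u) (le_refl (n : ℝ)) hab.le le_rfl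
        rw [intervalMean_eq hab.le, setIntegral_Icc_eq_intervalIntegral hab.le, h1, hFn]
        simpa using hBm (n + 1)
      have hmom : ENNReal.ofReal ((n + 1 : ℕ) : ℝ) ≤
          ∫⁻ x in Icc (n : ℝ) (n + 1), ENNReal.ofReal (glue F x ^ r) := by
        rw [← ofReal_integral_eq_lintegral_ofReal (hIcc (Real.continuous_rpow_const hr.le) hab.le)
          (ae_of_all _ fun x => Real.rpow_nonneg (hpos x).le _)]
        refine ENNReal.ofReal_le_ofReal ?_
        have h1 := integral_glue (F := F) (φ := fun u => u ^ r) (le_refl (n : ℝ)) hab.le le_rfl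
        rw [setIntegral_Icc_eq_intervalIntegral hab.le, h1, hFn]
        simpa using hBr (n + 1)
      have h2 : ENNReal.ofReal (((n + 1 : ℕ) : ℝ) ^ (1 / r) / g) ≤ ENNReal.ofReal K := by
        rw [← hK]
        refine le_trans ?_ hle
        rw [add_sub_cancel_left, ENNReal.ofReal_one, div_one,
          ENNReal.ofReal_div_of_pos (by linarith), ← ENNReal.ofReal_rpow_of_nonneg
          (Nat.cast_nonneg _) (by positivity)]
        gcongr
      exact (ENNReal.ofReal_le_ofReal_iff (le_max_right K 0)).1
        (h2.trans (ENNReal.ofReal_le_ofReal (le_max_left _ _)))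
    have hg0 : 0 < g := by linarith
    obtain ⟨n, hn'⟩ := exists_nat_gt ((max K 0 * g) ^ r)
    have h3 := hn n
    rw [div_le_iff₀ hg0] at h3
    have h4 : (((n + 1 : ℕ) : ℝ) ^ (1 / r)) ^ r ≤ (max K 0 * g) ^ r :=
      Real.rpow_le_rpow (by positivity) h3 hr.le
    rw [← Real.rpow_mul (Nat.cast_nonneg _), one_div_mul_cancel hr.ne', Real.rpow_one] at h4
    push_cast at h4
    linarith

/-! ### The power weight on the half-line. -/

theorem continuousOn_rpow_mul_log {c : ℝ} (hc : 0 < c) :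
    ContinuousOn (fun t : ℝ => t ^ c * Real.log t) (Ici 0) := by
  have h : Continuous fun t : ℝ => c⁻¹ * (t ^ c * Real.log (t ^ c)) :=
    continuous_const.mul (Real.continuous_mul_log.comp (Real.continuous_rpow_const hc.le))
  refine h.continuousOn.congr fun t ht => ?_
  rcases (show (0 : ℝ) ≤ t from ht).eq_or_lt with rfl | ht0
  · simp [Real.zero_rpow hc.ne']
  · simp only
    rw [Real.log_rpow ht0]
    field_simp

theorem intervalIntegrable_rpow_mul_log {s : ℝ} (hs : -1 < s) {a b : ℝ} (ha : 0 ≤ a)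
    (hab : a ≤ b) : IntervalIntegrable (fun t : ℝ => t ^ s * Real.log t) volume a b := by
  -- Splits t^s log t as t^(s-c) times t^c log t: still s - c > -1, and the second factor is
  -- continuous up to 0.
  set c := (s + 1) / 2
  have hc : 0 < c := by simp only [c]; linarith
  have hsub : uIcc a b ⊆ Ici 0 := by
    rw [uIcc_of_le hab]
    exact fun x hx => ha.trans hx.1
  have h1 : IntervalIntegrable (fun t : ℝ => t ^ (s - c)) volume a b :=
    intervalIntegral.intervalIntegrable_rpow' (by simp only [c]; linarith)
  refine (h1.mul_continuousOn ((continuousOn_rpow_mul_log hc).mono hsub)).congr ?_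
  intro t ht
  have ht0 : 0 < t := by
    rw [uIoc_of_le hab] at ht
    exact ha.trans_lt ht.1
  simp only
  rw [← mul_assoc, ← Real.rpow_add ht0, sub_add_cancel]

section power

variable {g : ℝ}

theorem isWeightOn_power (hg : 1 < g) : IsWeightOn (Ici 0) (fun t : ℝ => t ^ ((1 - g) / g)) := by
  have hs : -1 < (1 - g) / g := by rw [lt_div_iff₀ (by linarith)]; linarith
  refine ⟨fun x hx => ?_, ?_⟩
  · have hx0 : (0 : ℝ) ≤ x := hx
    refine ⟨Icc 0 (x + 1), ?_, ?_⟩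
    · rw [← Ici_inter_Iic]
      exact Filter.inter_mem self_mem_nhdsWithin
        (mem_nhdsWithin_of_mem_nhds (Iic_mem_nhds (by linarith)))
    · exact (intervalIntegrable_iff_integrableOn_Icc_of_le (by linarith)).1
        (intervalIntegral.intervalIntegrable_rpow' hs)
  · have h0 : ∀ᵐ x : ℝ ∂volume, x ≠ 0 := by simp [ae_iff, measure_singleton]
    filter_upwards [ae_restrict_mem measurableSet_Ici, ae_restrict_of_ae h0] with x hx hx0
    exact Real.rpow_pos_of_pos (lt_of_le_of_ne hx hx0.symm) _

/-- The base point is the value of the weight at b, its minimum on (a, b]. An explicit primitive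
vanishes at b and is nonnegative at a, by log y ≤ y - 1 with y = b^s / a^s for a > 0; for a = 0 it
vanishes at both ends. -/
theorem integral_tangentGap_power_nonpos (hg : 1 < g) {a b : ℝ} (ha : 0 ≤ a) (hab : a < b) :
    ∫ t in a..b, tangentGap g (b ^ ((1 - g) / g)) (t ^ ((1 - g) / g)) ≤ 0 := by
  have hg0 : 0 < g := by linarith
  have hb : 0 < b := ha.trans_lt hab
  set s := (1 - g) / g with hs
  have hs1 : -1 < s := by rw [hs, lt_div_iff₀ hg0]; linarith
  have hgs : g * s = 1 - g := by rw [hs]; field_simp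
  have hsg : s = 1 / g - 1 := by rw [hs]; field_simp
  have hig : 0 < 1 / g := by positivity
  have hbs : 0 < b ^ s := Real.rpow_pos_of_pos hb s
  set P : ℝ → ℝ := fun t =>
    (1 - g) * (t ^ (1 / g) * Real.log t) - ((1 - g) * Real.log b + g) * t ^ (1 / g) + g * b ^ s * t
  have hPc : ContinuousOn P (Icc a b) := by
    have hsub : Icc a b ⊆ Ici 0 := fun x hx => ha.trans hx.1
    have h1 := (continuousOn_rpow_mul_log hig).mono hsub
    have h2 : ContinuousOn (fun t : ℝ => t ^ (1 / g)) (Icc a b) :=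
      (Real.continuous_rpow_const hig.le).continuousOn
    exact ((continuousOn_const.mul h1).sub (continuousOn_const.mul h2)).add (by fun_prop)
  have hgap : ∀ t : ℝ, 0 < t → tangentGap g (b ^ s) (t ^ s) =
      s * (t ^ s * Real.log t) - (s * Real.log b + g) * t ^ s + g * b ^ s := by
    intro t ht
    rw [tangentGap, Real.log_div (Real.rpow_pos_of_pos ht s).ne' hbs.ne', Real.log_rpow ht,
      Real.log_rpow hb]
    ring
  have hPd : ∀ t ∈ Ioo a b, HasDerivAt P (tangentGap g (b ^ s) (t ^ s)) t := by
    intro t ht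
    have ht0 : 0 < t := ha.trans_lt ht.1
    have h1 : HasDerivAt (fun t : ℝ => t ^ (1 / g)) (1 / g * t ^ (1 / g - 1)) t :=
      Real.hasDerivAt_rpow_const (Or.inl ht0.ne')
    have h2 := ((((h1.mul (Real.hasDerivAt_log ht0.ne')).const_mul (1 - g)).sub
      (h1.const_mul ((1 - g) * Real.log b + g))).add
      ((hasDerivAt_id t).const_mul (g * b ^ s)))
    refine h2.congr_deriv ?_
    have e : t ^ (1 / g) = t ^ s * t := by
      rw [← Real.rpow_add_one ht0.ne', hsg, sub_add_cancel]
    rw [hgap t ht0, e, ← hsg, ← hgs]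
    field_simp
    linear_combination (t ^ s) * hgs
  have hint : IntervalIntegrable (fun t => tangentGap g (b ^ s) (t ^ s)) volume a b := by
    refine ((((intervalIntegrable_rpow_mul_log hs1 ha hab.le).const_mul s).sub
      ((intervalIntegral.intervalIntegrable_rpow' hs1).const_mul (s * Real.log b + g))).add
      (intervalIntegrable_const (c := g * b ^ s))).congr ?_
    intro t ht
    rw [uIoc_of_le hab.le] at ht
    exact (hgap t (ha.trans_lt ht.1)).symm
  rw [intervalIntegral.integral_eq_sub_of_hasDerivAt_of_le hab.le hPc hPd hint]
  have hPb : P b = 0 := by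
    have e : b ^ (1 / g) = b ^ s * b := by
      rw [← Real.rpow_add_one hb.ne', hsg, sub_add_cancel]
    simp only [P]
    rw [e]
    ring
  have hPa : 0 ≤ P a := by
    rcases ha.eq_or_lt with rfl | ha0
    · simp only [P]
      rw [Real.zero_rpow hig.ne']
      simp
    · have has : 0 < a ^ s := Real.rpow_pos_of_pos ha0 s
      have hlog : Real.log (b ^ s / a ^ s) ≤ b ^ s / a ^ s - 1 :=
        Real.log_le_sub_one_of_pos (by positivity)
      rw [Real.log_div hbs.ne' has.ne', Real.log_rpow ha0, Real.log_rpow hb] at hlog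
      have e : a ^ (1 / g) = a ^ s * a := by
        rw [← Real.rpow_add_one ha0.ne', hsg, sub_add_cancel]
      have : P a = g * (a ^ s * a) *
          (b ^ s / a ^ s - 1 - (s * Real.log b - s * Real.log a)) := by
        simp only [P]
        rw [e, ← hgs]
        field_simp
        ring
      rw [this]
      exact mul_nonneg (by positivity) (by linarith)
  linarith

theorem RHOneConst_power_le (hg : 1 < g) {C : ℝ} (hgC : g - Real.log g = C + 1) :
    RHOneConst (Ici 0) (fun t : ℝ => t ^ ((1 - g) / g)) ≤ C := by
  refine iSup_le fun a => iSup_le fun b => iSup_le fun hab => iSup_le fun hI => ?_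
  have ha : 0 ≤ a := hI (left_mem_Icc.2 hab.le)
  have hs : -1 < (1 - g) / g := by rw [lt_div_iff₀ (by linarith)]; linarith
  have hw := isWeightOn_power hg
  refine entropyMean_le_of_integral_tangentGap hab (hw.integrableOn_Icc hI) (hw.ae_pos_Icc hI)
    ?_ hg hgC (Real.rpow_pos_of_pos (ha.trans_lt hab) ((1 - g) / g)) ?_
  · refine (intervalIntegrable_iff_integrableOn_Icc_of_le hab.le).1
      (((intervalIntegrable_rpow_mul_log hs ha hab.le).const_mul ((1 - g) / g)).congr ?_)
    intro t ht
    rw [uIoc_of_le hab.le] at ht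
    simp only
    rw [Real.log_rpow (ha.trans_lt ht.1)]
    ring
  · rw [setIntegral_Icc_eq_intervalIntegral hab.le]
    exact integral_tangentGap_power_nonpos hg ha hab

/-- The critical power of the weight is 1/t, not integrable at 0. -/
theorem not_memRH_power (hg : 1 < g) :
    ¬ MemRH (g / (g - 1)) (Ici 0) (fun t : ℝ => t ^ ((1 - g) / g)) := by
  rintro ⟨hw, hlt⟩
  set w : ℝ → ℝ := fun t => t ^ ((1 - g) / g)
  set r := g / (g - 1) with hr
  have hg1 : g - 1 ≠ 0 := by linarith
  have hr0 : 0 < r := div_pos (by linarith) (by linarith)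
  have hpow : ∀ t : ℝ, 0 ≤ t → w t ^ r = t⁻¹ := fun t ht => by
    simp only [w]
    have : g ≠ 0 := by linarith
    rw [← Real.rpow_mul ht, hr, show (1 - g) / g * (g / (g - 1)) = -1 by field_simp; ring,
      Real.rpow_neg_one]
  have htop : ∫⁻ x in Icc (0 : ℝ) 1, ENNReal.ofReal (w x ^ r) = ⊤ := by
    by_contra hne
    have hint : IntegrableOn (fun x => w x ^ r) (Icc 0 1) := by
      have hm : AEMeasurable w (volume.restrict (Icc 0 1)) :=
        (hw.integrableOn_Icc Icc_subset_Ici_self).aemeasurable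
      refine (lintegral_ofReal_ne_top_iff_integrable (hm.pow_const r).aestronglyMeasurable
        ?_).1 hne
      filter_upwards [hw.ae_pos_Icc (Icc_subset_Ici_self : Icc (0 : ℝ) 1 ⊆ Ici 0)] with x hx
      exact Real.rpow_nonneg hx.le _
    have h1 : IntervalIntegrable (fun x : ℝ => x⁻¹) volume 0 1 :=
      (intervalIntegrable_iff_integrableOn_Icc_of_le zero_le_one).2
        (hint.congr_fun (fun x hx => hpow x hx.1) measurableSet_Icc)
    rw [intervalIntegrable_inv_iff] at h1
    simp at h1
  have hle : ((∫⁻ x in Icc (0 : ℝ) 1, ENNReal.ofReal (w x ^ r)) /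
      ENNReal.ofReal (1 - 0)) ^ (1 / r) /
      ENNReal.ofReal (intervalMean w 0 1) ≤ RHConst r (Ici 0) w :=
    le_iSup_of_le 0 (le_iSup_of_le 1
      (le_iSup_of_le one_pos (le_iSup_of_le Icc_subset_Ici_self le_rfl)))
  rw [htop, sub_zero, ENNReal.ofReal_one, div_one, ENNReal.top_rpow_of_pos (by positivity),
    ENNReal.top_div_of_ne_top ENNReal.ofReal_ne_top] at hle
  exact hlt.not_ge hle

end power

/-! ### Exact value of the constant, and the theorem. -/

/-- If self-improvement fails at the exponent attached to `C`, the `RH_1` constant is not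
below `C`. -/
theorem RHOneConst_eq_of_not_memRH {I : Set ℝ} {w : ℝ → ℝ} {C g : ℝ} (hw : IsWeightOn I w)
    (hC : 0 < C) (hg : 1 < g) (hgC : g - Real.log g = C + 1) (hle : RHOneConst I w ≤ C)
    (hnot : ¬ MemRH (1 + 1 / (g - 1)) I w) : RHOneConst I w = C := by
  refine le_antisymm hle (not_lt.1 fun hlt => hnot ?_)
  obtain ⟨q, hq1, hq2⟩ := EReal.lt_iff_exists_real_btwn.1 hlt
  have hq2 : q < C := by exact_mod_cast hq2
  -- The maximum with C / 2 keeps Q positive, as needed for a root k > 1.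
  set Q := max q (C / 2)
  have hQ0 : 0 < Q := lt_max_of_lt_right (by linarith)
  have hQC : Q < C := max_lt hq2 (by linarith)
  obtain ⟨k, hk, hkQ⟩ := exists_sub_log_eq hQ0
  have hkg : k < g := by
    by_contra! h
    have := strictMonoOn_sub_log.monotoneOn (mem_Ici.2 hg.le) (mem_Ici.2 hk.le) h
    linarith
  refine memRH_of_entropyMean_le hw hk hkQ (fun a b hab hI => ?_)
    (one_div_pos.2 (by linarith)) (one_div_lt_one_div_of_lt (by linarith) (by linarith))
  exact (entropyMean_le_RHOneConst hab hI).trans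
    (hq1.le.trans (by exact_mod_cast le_max_left _ _))

/-- Sharp Gehring lemma for `p = 1` in dimension one. -/
theorem theorem1p4 :
    -- the numbers `ε₋` and `γ₊` exist for every `Q > 0`, and `ε₋ = 1 / (γ₊ - 1)`
    (∀ Q : ℝ, 0 < Q → ∃ g e : ℝ, IsGammaPlus Q g ∧ IsEpsMinus Q e ∧ 1 < g ∧ e = 1 / (g - 1)) ∧
    -- self-improvement, on the real line and on every other nondegenerate interval
    (∀ (I : Set ℝ) (w : ℝ → ℝ), I.OrdConnected → (interior I).Nonempty → MemRHOne I w →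
      (∀ e : ℝ, IsEpsMinus (RHOneConst I w).toReal e →
        ∀ ε : ℝ, 0 < ε → ε < e → MemRH (1 + ε) I w) ∧
      -- the degenerate case: the equation has no positive solution, and `ε₋ = +∞`
      (RHOneConst I w = 0 → ∀ ε : ℝ, 0 < ε → MemRH (1 + ε) I w)) ∧
    -- sharpness on the real line
    (∀ C e : ℝ, 0 < C → IsEpsMinus C e →
      ∃ w : ℝ → ℝ, MemRHOne univ w ∧ RHOneConst univ w = (C : EReal) ∧
        ¬ MemRH (1 + e) univ w) ∧
    -- sharpness on the half-line, with a power weight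
    (∀ C g e : ℝ, 0 < C → IsGammaPlus C g → IsEpsMinus C e →
      MemRHOne (Ici 0) (fun t : ℝ => t ^ ((1 - g) / g)) ∧
        RHOneConst (Ici 0) (fun t : ℝ => t ^ ((1 - g) / g)) = (C : EReal) ∧
        ¬ MemRH (1 + e) (Ici 0) (fun t : ℝ => t ^ ((1 - g) / g))) := by
  refine ⟨fun Q hQ => ?_, fun I w _ _ hmem => ⟨fun e he ε hε hεe => ?_, fun h0 ε hε => ?_⟩,
    fun C e hC he => ?_, fun C g e hC hg he => ?_⟩
  · obtain ⟨g, hg, hgQ⟩ := exists_sub_log_eq hQ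
    exact ⟨g, 1 / (g - 1), isGammaPlus_of_eq hg hgQ, isEpsMinus_of_eq hg hgQ, hg, rfl⟩
  · obtain ⟨hQ, g, hg, hgQ, rfl⟩ := he.exists_root
    refine memRH_of_entropyMean_le hmem.1 hg hgQ (fun a b hab hI => ?_) hε hεe
    exact (entropyMean_le_RHOneConst hab hI).trans (EReal.le_coe_toReal hmem.2.ne)
  -- The choice g = 1 + 1/(2ε) has critical value 1/(g-1) = 2ε > ε, and its Q is positive, hence an
  -- upper bound for the entropies.
  · have hpos : 0 < 1 / (2 * ε) := by positivity
    have hlog := log_lt_sub_one_of_one_lt (by linarith : 1 < 1 + 1 / (2 * ε))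
    refine memRH_of_entropyMean_le (g := 1 + 1 / (2 * ε))
      (Q := 1 / (2 * ε) - Real.log (1 + 1 / (2 * ε))) hmem.1 (by linarith) (by ring)
      (fun a b hab hI => ?_) hε ?_
    · refine (entropyMean_le_RHOneConst hab hI).trans ?_
      rw [h0]
      exact_mod_cast (by linarith : 0 ≤ 1 / (2 * ε) - Real.log (1 + 1 / (2 * ε)))
    · rw [add_sub_cancel_left, one_div_one_div]
      linarith
  · obtain ⟨-, g, hg, hgC, rfl⟩ := he.exists_root
    obtain ⟨w, hw, hle, hnot⟩ := exists_line_weight hg hgC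
    have hexp : g / (g - 1) = 1 + 1 / (g - 1) := by
      have : g - 1 ≠ 0 := by linarith
      field_simp
      ring
    rw [hexp] at hnot
    exact ⟨w, ⟨hw, hle.trans_lt (EReal.coe_lt_top C)⟩,
      RHOneConst_eq_of_not_memRH hw hC hg hgC hle hnot, hnot⟩
  · obtain ⟨-, g', hg', hgC, rfl⟩ := he.exists_root
    obtain rfl := hg.eq_of_root hg' hgC
    have hw := isWeightOn_power hg'
    have hle := RHOneConst_power_le hg' hgC
    have hnot := not_memRH_power hg'
    have hexp : g / (g - 1) = 1 + 1 / (g - 1) := by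
      have : g - 1 ≠ 0 := by linarith
      field_simp
      ring
    rw [hexp] at hnot
    exact ⟨⟨hw, hle.trans_lt (EReal.coe_lt_top C)⟩,
      RHOneConst_eq_of_not_memRH hw hC hg' hgC hle hnot, hnot⟩
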